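/- Let $B\ge 0$ and $a>0$. There is $\kappa_0>0$, depending only on $B$ and $a$, such that the following holds for every $\kappa\ge\kappa_0$. Let $X$ be a measurable space and let $\rho$ be a probability measure on $X\times\mathbb R$, with marginal $\rho_X$ on $X$, such that $|y|\le B$ for $\rho$-almost every $(x,y)$; let $f_\rho(x)=E(y\mid x)$ be its regression function and let $\|u\|^2=\int_X|u|^2\,d\rho_X$. Let $\mathcal D$ be a dictionary of measurable functions in $L_2(\rho_X)$, written as the union of finite nonempty sets $\mathcal D_1\subset\mathcal D_2\subset\cdots$ with $\#(\mathcal D_m)\le m$, and suppose that $\mathcal D$ is complete in $L_2(\rho_X)$, that is, the linear span of $\mathcal D$ is dense in $L_2(\rho_X)$. For a sample $\mathbf z=((x_1,y_1),\dots,(x_n,y_n))$, $n\ge1$, write $\langle u,v\rangle_n=\frac1n\sum_i u_iv_i$ for $u,v\in\mathbb R^n$, let $\|\cdot\|_n$ be the corresponding norm, and identify a function $f$ on $X$ with the vector $(f(x_i))_i$ and the data $y$ with $(y_i)_i$ in these expressions. Put $m=\lfloor n^a\rfloor$, $\hat f_0=0$, and for $k\ge1$ construct functions $g_k\in\mathcal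 D_m$ and $\hat f_k$ on $X$ by one of the following three greedy algorithms, ties being broken arbitrarily: * (orthogonal greedy algorithm) $g_k$ maximizes $|\langle y-\hat f_{k-1},\,g/\|g\|_n\rangle_n|$ over $g\in\mathcal D_m$ (this quantity being read as $0$ if $\|g\|_n=0$), and $\hat f_k\in\mathrm{Span}\{g_1,\dots,g_k\}$ is an orthogonal projection of $y$ onto $\mathrm{Span}\{g_1,\dots,g_k\}$ for $\langle\cdot,\cdot\rangle_n$; * (relaxed greedy algorithm) $\hat f_k=\alpha_k\hat f_{k-1}+\beta_kg_k$, where $\alpha_1=0$, $\alpha_k=1-2/k$ for $k>1$, and $(\beta_k,g_k)$ minimizes $\|y-\alpha_k\hat f_{k-1}-\beta g\|_n$ over $(\beta,g)\in\mathbb R\times\mathcal D_m$; * (stepwise projection algorithm) $g_k$ minimizes over $g\in\mathcal D_m$ the $\|\cdot\|_n$-distance from $y$ to $\mathrm{Span}\{g_1,\dots,g_{k-1},g\}$, and $\hat f_k\in\mathrm{Span}\{g_1,\dots,g_k\}$ is an orthogonal projection of $y$ onto $\mathrm{Span}\{g_1,\dots,g_k\}$ for $\langle\cdot,\cdot\rangle_n$.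 With $T u=\min\{B,|u|\}\,\mathrm{sgn}(u)$, let $\hat f=T\hat f_{k^*}$, where $k^*$ minimizes $$\|y-T\hat f_k\|_n^2+\kappa\,\frac{k\log n}{n}$$ over all integers $k>0$. Then the estimator is universally consistent: if the sample consists of $n$ independent draws from $\rho$, $$\lim_{n\to\infty}E\big(\|\hat f-f_\rho\|^2\big)=0,$$ the expectation being taken with respect to $\rho^n$ (as an upper expectation, i.e. the infimum of the expectations of measurable majorants, if the tie-breaking makes $\|\hat f-f_\rho\|^2$ a non-measurable function of the sample). -/

import Mathlib

open MeasureTheory Filter Topology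
open scoped ENNReal

noncomputable section

namespace GreedyLearning

/-! ### Empirical quantities attached to a sample `z = (xᵢ, yᵢ)`, `i = 1, …, n` -/

section Empirical

variable {X : Type*} {n : ℕ}

/-- The empirical inner product `(1/n) ∑ uᵢ vᵢ` of two functions given by their values on the
design. -/
def empInner (u v : Fin n → ℝ) : ℝ := (1 / (n : ℝ)) * ∑ i, u i * v i

/-- The empirical norm, `‖u‖ₙ² = (1/n) ∑ |uᵢ|²`. -/
def empNorm (u : Fin n → ℝ) : ℝ := Real.sqrt (empInner u u)

/-- The values `(f(x₁), …, f(xₙ))` of `f` on the design. -/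
def onDesign (z : Fin n → X × ℝ) (f : X → ℝ) : Fin n → ℝ := fun i => f (z i).1

/-- The residual `y - f` on the design. -/
def residual (z : Fin n → X × ℝ) (f : X → ℝ) : Fin n → ℝ := fun i => (z i).2 - f (z i).1

/-- `g / ‖g‖ₙ` on the design (it is `0` when `‖g‖ₙ = 0`, i.e. when `g` vanishes on the design). -/
def empNormalized (z : Fin n → X × ℝ) (g : X → ℝ) : Fin n → ℝ :=
  (empNorm (onDesign z g))⁻¹ • onDesign z g

/-- `V_k = span {g₁, …, g_k}`, a space of functions on all of `X`. -/
def selectedSpan (g : ℕ → X → ℝ) (k : ℕ) : Submodule ℝ (X → ℝ) :=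
  Submodule.span ℝ (g '' Set.Icc 1 k)

/-- `f` is (a function on `X` representing) the orthogonal projection of the data `y` onto `V`
for the empirical inner product. -/
def IsEmpProjection (z : Fin n → X × ℝ) (V : Submodule ℝ (X → ℝ)) (f : X → ℝ) : Prop :=
  f ∈ V ∧ ∀ v ∈ V, empInner (residual z f) (onDesign z v) = 0

/-! ### The greedy algorithms, run on the data with a finite dictionary `D`

`f k` is the `k`-th approximant and `g k`, `k ≥ 1`, the element selected at step `k`. Ties are
broken arbitrarily. -/

/-- Orthogonal greedy algorithm: `g_{k+1}` maximizes `|⟨y - f_k, g⟩ₙ|` over the dictionary elements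
normalized in the empirical norm; `f_{k+1}` is the projection of `y` onto
`span {g₁, …, g_{k+1}}`. -/
def IsOGARun (D : Finset (X → ℝ)) (z : Fin n → X × ℝ) (f g : ℕ → X → ℝ) : Prop :=
  f 0 = 0 ∧ ∀ k : ℕ,
    g (k + 1) ∈ D ∧
    (∀ g' ∈ D, |empInner (residual z (f k)) (empNormalized z g')| ≤
      |empInner (residual z (f k)) (empNormalized z (g (k + 1)))|) ∧
    IsEmpProjection z (selectedSpan g (k + 1)) (f (k + 1))

/-- Relaxation parameters `α₁ = 0`, `α_k = 1 - 2/k` for `k > 1`. -/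
def relaxation (k : ℕ) : ℝ := if k ≤ 1 then 0 else 1 - 2 / (k : ℝ)

/-- Relaxed greedy algorithm: `f_{k+1} = α_{k+1} f_k + β_{k+1} g_{k+1}`, where
`(β_{k+1}, g_{k+1})` minimizes `‖y - α_{k+1} f_k - β g‖ₙ` over `(β, g) ∈ ℝ × D`. -/
def IsRGARun (D : Finset (X → ℝ)) (z : Fin n → X × ℝ) (f g : ℕ → X → ℝ) : Prop :=
  f 0 = 0 ∧ ∀ k : ℕ,
    g (k + 1) ∈ D ∧
    ∃ β : ℝ, f (k + 1) = relaxation (k + 1) • f k + β • g (k + 1) ∧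
      ∀ β' : ℝ, ∀ g' ∈ D,
        empNorm (residual z (f (k + 1))) ≤
          empNorm (residual z (relaxation (k + 1) • f k + β' • g'))

/-- Stepwise projection algorithm: `f_{k+1}` is the projection of `y` onto
`span {g₁, …, g_{k+1}}`, where `g_{k+1}` minimizes over `g' ∈ D` the distance from `y` to
`span {g₁, …, g_k, g'}`. -/
def IsSPARun (D : Finset (X → ℝ)) (z : Fin n → X × ℝ) (f g : ℕ → X → ℝ) : Prop :=
  f 0 = 0 ∧ ∀ k : ℕ,
    g (k + 1) ∈ D ∧
    IsEmpProjection z (selectedSpan g (k + 1)) (f (k + 1)) ∧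
    ∀ g' ∈ D, ∀ v ∈ selectedSpan g k ⊔ Submodule.span ℝ {g'},
      empNorm (residual z (f (k + 1))) ≤ empNorm (residual z v)

/-- The three greedy algorithms. -/
inductive GreedyAlgorithm
  | orthogonal
  | relaxed
  | stepwiseProjection

/-- `(f_k, g_k)` is a run of the given greedy algorithm on the sample `z`. -/
def IsGreedyRun (alg : GreedyAlgorithm) (D : Finset (X → ℝ)) (z : Fin n → X × ℝ)
    (f g : ℕ → X → ℝ) : Prop :=
  match alg with
  | .orthogonal => IsOGARun D z f g
  | .relaxed => IsRGARun D z f g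
  | .stepwiseProjection => IsSPARun D z f g

/-! ### The estimator -/

/-- The truncation operator `T_B u = min {B, |u|} sgn u`. -/
def truncation (B u : ℝ) : ℝ := min B |u| * Real.sign u

/-- The penalized empirical risk `‖y - T_B f_k‖ₙ² + κ k log n / n`. -/
def penalizedRisk (B κ : ℝ) (z : Fin n → X × ℝ) (f : ℕ → X → ℝ) (k : ℕ) : ℝ :=
  empNorm (residual z (fun x => truncation B (f k x))) ^ 2 + κ * (k * Real.log n / n)

/-- `fhat = T_B f_{k*}`, where `(f_k)` comes from a run of the greedy algorithm on the sample and
`k*` minimizes the penalized empirical risk over all `k > 0`. -/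
def IsGreedyEstimator (alg : GreedyAlgorithm) (B κ : ℝ) (D : Finset (X → ℝ))
    (z : Fin n → X × ℝ) (fhat : X → ℝ) : Prop :=
  ∃ f g : ℕ → X → ℝ, IsGreedyRun alg D z f g ∧
    ∃ k : ℕ, 0 < k ∧
      (∀ j : ℕ, 0 < j → penalizedRisk B κ z f k ≤ penalizedRisk B κ z f j) ∧
      fhat = fun x => truncation B (f k x)

end Empirical

/-! ### Dictionaries -/

/-- `D₁ ⊆ D₂ ⊆ ⋯` is an exhaustion of the dictionary by finite nonempty sets, `Dₘ` having at most
`m` elements (exactly `m` is possible only for an infinite dictionary; a finite one may be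
exhausted by an eventually constant sequence). -/
structure IsExhaustion {X : Type*} (dict : Set (X → ℝ)) (D : ℕ → Finset (X → ℝ)) : Prop where
  mono : Monotone D
  card_le : ∀ m, (D m).card ≤ m
  nonempty : ∀ m, 0 < m → (D m).Nonempty
  iUnion_eq : ⋃ m, (D m : Set (X → ℝ)) = dict

/-- The dictionary is complete in `L₂(μ)`: the linear span of (the classes of) its elements is
dense in `L₂(μ)`. -/
def IsCompleteDictionary {X : Type*} [MeasurableSpace X] (μ : Measure X)
    (dict : Set (X → ℝ)) : Prop :=
  Dense (Submodule.span ℝ {F : Lp ℝ 2 μ | ∃ g ∈ dict, F =ᵐ[μ] g} : Set (Lp ℝ 2 μ))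

/-! ### Regression function and expected error -/

/-- The regression function `f_ρ(x) = E(y | x) = ∫ y dρ(y | x)`. -/
def regressionFunction {X : Type*} [MeasurableSpace X] (ρ : Measure (X × ℝ))
    [IsFiniteMeasure ρ] (x : X) : ℝ :=
  ∫ y, y ∂(ρ.condKernel x)

/-- The squared error `‖u - f_ρ‖²` in `L₂(ρ_X)`, `ρ_X` the marginal of `ρ` on `X`. -/
def squaredError {X : Type*} [MeasurableSpace X] (ρ : Measure (X × ℝ)) [IsFiniteMeasure ρ]
    (u : X → ℝ) : ℝ≥0∞ :=
  eLpNorm (fun x => u x - regressionFunction ρ x) 2 ρ.fst ^ 2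

/-- The (upper) expectation of a nonnegative function: the infimum of the integrals of its
measurable majorants. It is the usual expectation for a measurable function, and makes sense
whichever way the ties in the greedy algorithm are broken. -/
def upperExpectation {Ω : Type*} [MeasurableSpace Ω] (μ : Measure Ω) (F : Ω → ℝ≥0∞) : ℝ≥0∞ :=
  ⨅ (φ : Ω → ℝ≥0∞) (_ : Measurable φ) (_ : F ≤ φ), ∫⁻ ω, φ ω ∂μ

theorem lintegral_le_upperExpectation {Ω : Type*} [MeasurableSpace Ω] (μ : Measure Ω)
    (F : Ω → ℝ≥0∞) : ∫⁻ ω, F ω ∂μ ≤ upperExpectation μ F :=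
  le_iInf fun _ => le_iInf fun _ => le_iInf fun hle => lintegral_mono hle

theorem upperExpectation_eq_lintegral {Ω : Type*} [MeasurableSpace Ω] (μ : Measure Ω)
    (F : Ω → ℝ≥0∞) (hF : Measurable F) : upperExpectation μ F = ∫⁻ ω, F ω ∂μ :=
  le_antisymm (iInf_le_of_le F (iInf_le_of_le hF (iInf_le _ le_rfl)))
    (lintegral_le_upperExpectation μ F)

end GreedyLearning

end

namespace GreedyLearning

/-! ### Truncation -/

/-! The proof rests on a uniform deviation bound, a convergence rate for the greedy algorithms, and
a penalty that ties them together.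

Deviation. For a truncated combination `u` of `k` dictionary elements, let `r(u)` be its squared
distance to the regression function and `e(u)` its mean excess loss on the sample. With `λ` of order
`1/(B+1)²`, the supremum over all `k`, all choices of elements and all coefficients of `exp(λ n
(r(u) - 2 e(u)) - (a + 11) k log n)` has expectation at most `exp 1`
(`IsRegression.lintegral_expDeviation_le`). By Jensen, a ghost sample replaces `r(u) - 2 e(u)` by a
mean of `pairLoss` over pairs, whose law is invariant under swapping the entries of each pair.
Averaging over the swaps produces factors `cosh x ≤ exp(x²/2)`. Because the square loss has variance
controlled by `r(u)`, the squared distances subtracted in `pairLoss` pay for `x²/2`, so each fixed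
`u` contributes at most 1. The supremum over coefficients is reduced to a finite one on the double
sample: thresholds of a `k`-dimensional space cut out polynomially many sets, by Sauer-Shelah. The
choice of elements costs at most `n ^ (a k)`. Both costs are powers of `n` with exponent linear in
`k`, hence the penalty `k log n`.

Approximation. For every combination `h` of elements of the finite dictionary, the squared empirical
residual after `j` steps exceeds that of `h` by at most `4 Q / j`, with `Q` depending on `h` and the
data (`IsGreedyRun.empNorm_residual_sq_le`).

Conclusion. For large `κ` the penalty dominates the deviation term at the random index `k*`, and
minimality of `k*` allows comparison with any fixed `j`. The expected error is thus at most `exp 1 /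
(λ n) + 2 ‖h - f_ρ‖² + C(h) / j + 2 κ j log n / n`. Completeness gives `h`, then `j` is chosen, then
`n` tends to infinity. -/

theorem truncation_eq_max_min {B : ℝ} (hB : 0 ≤ B) (u : ℝ) :
    truncation B u = max (-B) (min B u) := by
  unfold truncation
  rcases lt_trichotomy u 0 with h | h | h
  · rw [Real.sign_of_neg h, abs_of_neg h, min_eq_right (by linarith : u ≤ B)]
    rcases le_total B (-u) with h' | h'
    · rw [min_eq_left h', max_eq_left (by linarith)]; ring
    · rw [min_eq_right h', max_eq_right (by linarith)]; ring
  · subst h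
    simp [hB]
  · rw [Real.sign_of_pos h, abs_of_pos h, mul_one, max_eq_right]
    exact le_trans (by linarith) (le_min hB h.le)

theorem abs_truncation_le {B : ℝ} (hB : 0 ≤ B) (u : ℝ) : |truncation B u| ≤ B := by
  rw [truncation_eq_max_min hB, abs_le]
  exact ⟨le_max_left _ _, max_le (by linarith) (min_le_left _ _)⟩

theorem truncation_of_abs_le {B u : ℝ} (hu : |u| ≤ B) : truncation B u = u := by
  have h := abs_le.1 hu
  rw [truncation_eq_max_min ((abs_nonneg u).trans hu), min_eq_right h.2, max_eq_right h.1]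

theorem continuous_truncation {B : ℝ} (hB : 0 ≤ B) : Continuous (truncation B) := by
  rw [funext (truncation_eq_max_min hB)]
  fun_prop

theorem sq_sub_truncation_le {B y : ℝ} (hy : |y| ≤ B) (u : ℝ) :
    (y - truncation B u) ^ 2 ≤ (y - u) ^ 2 := by
  have h := abs_le.1 hy
  rw [truncation_eq_max_min ((abs_nonneg y).trans hy)]
  rcases le_total B u with h1 | h1
  · rw [min_eq_left h1, max_eq_right (by linarith)]
    nlinarith
  · rw [min_eq_right h1]
    rcases le_total (-B) u with h2 | h2
    · rw [max_eq_right h2]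
    · rw [max_eq_left h2]
      nlinarith

/-- Two reals exceeding the same thresholds of a grid of mesh `2b/n` on `[-b, b]` have close
truncations. -/
theorem truncation_sub_le_of_grid {B b : ℝ} (hB : 0 ≤ B) (hBb : B ≤ b) (hb : 0 < b) {n : ℕ}
    (hn : 0 < n) {u v : ℝ}
    (h : ∀ j : Fin (n + 1), -b + j * (2 * b / n) < u → -b + j * (2 * b / n) < v) :
    truncation B u - truncation B v ≤ 2 * b / n := by
  by_contra! hlt
  rw [truncation_eq_max_min hB, truncation_eq_max_min hB] at hlt
  have hn' : (0 : ℝ) < n := by exact_mod_cast hn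
  have hd : 0 < 2 * b / n := by positivity
  set d := 2 * b / n with hd_def
  have hnd : n * d = 2 * b := by rw [hd_def]; field_simp
  set p := max (-B) (min B u)
  set q := max (-B) (min B v)
  have hpB : p ≤ B := max_le (by linarith) (min_le_left _ _)
  have hqB : -B ≤ q := le_max_left _ _
  have hpu : -B < p → p ≤ u := fun h' => by
    rcases max_choice (-B) (min B u) with h'' | h''
    · exact absurd h' (by simp [p, h''])
    · exact h''.trans_le (min_le_right _ _)
  have hqv : q < B → v ≤ q := fun h' => by
    by_contra! hc
    exact absurd (lt_min h' hc) (not_lt.2 (le_max_right _ _))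
  -- The first grid point at or above `q` lies below `p`, so `u` exceeds it while `v` does not.
  set j := ⌈(q + b) / d⌉₊
  have hj1 : (q + b) / d ≤ j := Nat.le_ceil _
  have hj2 : (j : ℝ) < (q + b) / d + 1 := Nat.ceil_lt_add_one (div_nonneg (by linarith) hd.le)
  have hj1' : q + b ≤ j * d := (div_le_iff₀ hd).1 hj1
  have hj2' : j * d < q + b + d := by
    have := mul_lt_mul_of_pos_right hj2 hd
    rwa [add_mul, div_mul_cancel₀ _ hd.ne', one_mul] at this
  have hjn : j < n + 1 := by
    have : (j : ℝ) * d < (n + 1 : ℝ) * d := by nlinarith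
    exact_mod_cast lt_of_mul_lt_mul_right this hd.le
  have h1 := h ⟨j, hjn⟩ (by
    have := hpu (by linarith)
    simp only
    linarith)
  have h2 := hqv (by linarith)
  simp only at h1
  linarith

/-! ### Sign patterns of linear spaces -/

section SignPatterns

variable {α W : Type*} [Fintype α] [DecidableEq α] [AddCommGroup W] [Module ℝ W]

open Classical in
/-- The sets of positivity of the functions in the range of `L`. -/
noncomputable def positivitySets (L : W →ₗ[ℝ] α → ℝ) : Finset (Finset α) :=
  (Set.toFinite (Set.range fun w => Finset.univ.filter fun a => 0 < L w a)).toFinset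

variable [FiniteDimensional ℝ W]

/-- On more points than the dimension, the restricted values satisfy a nontrivial linear relation. A
function positive exactly where the coefficients are positive would make the relation strictly
positive, so no coefficient is positive; applying this to the negated coefficients forces all of
them to vanish. -/
theorem card_le_finrank_of_shatters (L : W →ₗ[ℝ] α → ℝ) {A : Finset α}
    (hA : (positivitySets L).Shatters A) : A.card ≤ Module.finrank ℝ W := by
  classical
  by_contra! hlt
  let R : (α → ℝ) →ₗ[ℝ] (A → ℝ) := LinearMap.funLeft ℝ ℝ Subtype.val
  have hne : LinearMap.range (R ∘ₗ L) ≠ ⊤ := fun htop => by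
    have h1 := LinearMap.finrank_range_le (R ∘ₗ L)
    rw [htop, finrank_top, Module.finrank_fintype_fun_eq_card, Fintype.card_coe] at h1
    omega
  obtain ⟨φ, hφ0, hφ⟩ := Submodule.exists_le_ker_of_lt_top _ (lt_top_iff_ne_top.2 hne)
  have hrel : ∀ w, ∑ a : A, L w a * φ (Pi.single a 1) = 0 := fun w => by
    have h1 : φ ((R ∘ₗ L) w) = 0 := hφ ⟨w, rfl⟩
    rw [LinearMap.pi_apply_eq_sum_univ φ] at h1
    have h2 : ∀ x : A, (fun j => if x = j then (1 : ℝ) else 0) = Pi.single x 1 := fun x => by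
      ext j
      simp [Pi.single_apply, eq_comm]
    simp only [h2] at h1
    simpa [R, LinearMap.funLeft_apply] using h1
  have key : ∀ γ : A → ℝ, (∀ w, ∑ a : A, L w a * γ a = 0) → ∀ a, ¬ 0 < γ a := fun γ hγ a ha => by
    obtain ⟨P, hP, hPA⟩ := hA (t := (Finset.univ.filter fun a : A => 0 < γ a).map
      (Function.Embedding.subtype _)) (fun x hx => by
        simp only [Finset.mem_map, Function.Embedding.coe_subtype] at hx
        obtain ⟨y, -, rfl⟩ := hx
        exact y.2)
    simp only [positivitySets, Set.Finite.mem_toFinset, Set.mem_range] at hP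
    obtain ⟨w, rfl⟩ := hP
    have hiff : ∀ x : A, 0 < L w x ↔ 0 < γ x := fun x => by
      have := Finset.ext_iff.1 hPA x
      simpa using this
    have hpos : 0 < ∑ a : A, L w a * γ a := by
      refine Finset.sum_pos' (fun x _ => ?_) ⟨a, Finset.mem_univ _, mul_pos ((hiff a).2 ha) ha⟩
      by_cases hx : 0 < γ x
      · exact (mul_pos ((hiff x).2 hx) hx).le
      · exact mul_nonneg_of_nonpos_of_nonpos (not_lt.1 fun h => hx ((hiff x).1 h)) (not_lt.1 hx)
    exact hpos.ne' (hγ w)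
  refine hφ0 (LinearMap.pi_ext' fun a => LinearMap.ext_ring ?_)
  have h1 := key _ hrel a
  have h2 := key (fun a => -φ (Pi.single a 1))
    (fun w => by simpa [Finset.sum_neg_distrib] using hrel w) a
  simp only [Left.neg_pos_iff, not_lt] at h1 h2
  simpa using le_antisymm h1 h2

theorem sum_choose_le_pow (N d : ℕ) : ∑ i ∈ Finset.Iic d, N.choose i ≤ (N + 1) ^ d := by
  rw [add_pow, show Finset.Iic d = Finset.range (d + 1) by ext; simp]
  refine Finset.sum_le_sum fun i hi => ?_
  rw [one_pow, mul_one]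
  exact (Nat.choose_le_pow N i).trans
    (Nat.le_mul_of_pos_right _ (Nat.choose_pos (Nat.lt_succ_iff.1 (Finset.mem_range.1 hi))))

/-- Sauer-Shelah turns the dimension bound on shattered sets into polynomial growth. -/
theorem card_positivitySets_le (L : W →ₗ[ℝ] α → ℝ) :
    (positivitySets L).card ≤ (Fintype.card α + 1) ^ Module.finrank ℝ W := by
  have hvc : (positivitySets L).vcDim ≤ Module.finrank ℝ W :=
    Finset.sup_le fun A hA => card_le_finrank_of_shatters L (Finset.mem_shatterer.1 hA)
  calc (positivitySets L).card ≤ _ := Finset.card_le_card_shatterer _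
    _ ≤ _ := Finset.card_shatterer_le_sum_vcDim
    _ ≤ _ := sum_choose_le_pow _ _
    _ ≤ _ := Nat.pow_le_pow_right (Nat.succ_pos _) hvc

end SignPatterns

/-- A truncated `k`-dimensional space of functions on a finite set has small covering numbers in
the uniform norm. -/
theorem exists_truncation_cover {B b : ℝ} (hB : 0 ≤ B) (hBb : B ≤ b) (hb : 0 < b) {n : ℕ}
    (hn : 0 < n) {ι : Type*} [Fintype ι] {k : ℕ} (Φ : ι → Fin k → ℝ) :
    ∃ C : Finset (Fin k → ℝ), C.card ≤ (Fintype.card ι * (n + 1) + 1) ^ (k + 1) ∧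
      ∀ c : Fin k → ℝ, ∃ c' ∈ C, ∀ i,
        |truncation B (∑ l, c l * Φ i l) - truncation B (∑ l, c' l * Φ i l)| ≤ 2 * b / n := by
  classical
  -- The extra coordinate multiplies the threshold, so that comparisons with all grid levels are
  -- positivity sets of a single linear space of dimension `k + 1`; it is used at the value 1.
  let L : ((Fin k → ℝ) × ℝ) →ₗ[ℝ] (ι × Fin (n + 1)) → ℝ :=
    { toFun := fun w p => ∑ l, w.1 l * Φ p.1 l - w.2 * (-b + p.2 * (2 * b / n))
      map_add' := fun w w' => by
        ext p
        simp only [Prod.fst_add, Prod.snd_add, Pi.add_apply, add_mul, Finset.sum_add_distrib]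
        ring
      map_smul' := fun r w => by
        ext p
        simp only [Prod.smul_fst, Prod.smul_snd, Pi.smul_apply, smul_eq_mul, RingHom.id_apply,
          mul_assoc, mul_sub, Finset.mul_sum] }
  let pat : (Fin k → ℝ) → Finset (ι × Fin (n + 1)) :=
    fun c => Finset.univ.filter fun p => 0 < L (c, 1) p
  have hpat : ∀ c, pat c ∈ positivitySets L := fun c => by
    simp only [positivitySets, Set.Finite.mem_toFinset, Set.mem_range]
    exact ⟨(c, 1), by simp [pat]⟩
  -- One representative coefficient vector is kept per pattern; the value 0 covers patterns attained
  -- only with another last coordinate.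
  refine ⟨(positivitySets L).image fun P => if h : ∃ c, pat c = P then h.choose else 0,
    Finset.card_image_le.trans ((card_positivitySets_le L).trans ?_), fun c => ?_⟩
  · simp
  · have hex : ∃ c', pat c' = pat c := ⟨c, rfl⟩
    have hiff : ∀ c', pat c' = pat c → ∀ (i : ι) (j : Fin (n + 1)),
        -b + j * (2 * b / n) < ∑ l, c' l * Φ i l ↔
          -b + j * (2 * b / n) < ∑ l, c l * Φ i l := fun c' h i j => by
      simpa [pat, L] using Finset.ext_iff.1 h (i, j)
    refine ⟨hex.choose, Finset.mem_image.2 ⟨pat c, hpat c, dif_pos hex⟩, fun i => ?_⟩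
    have hle := hiff _ hex.choose_spec i
    rw [abs_sub_le_iff]
    exact ⟨truncation_sub_le_of_grid hB hBb hb hn fun j => (hle j).2,
      truncation_sub_le_of_grid hB hBb hb hn fun j => (hle j).1⟩

/-! ### Symmetrization by swapping the coordinates of a double sample -/

section Swap

variable {Z : Type*} {n : ℕ}

/-- Exchange the two entries of the pairs `w i` for which `ε i` holds. -/
def swapBy (ε : Fin n → Bool) (w : Fin n → Z × Z) : Fin n → Z × Z :=
  fun i => if ε i then (w i).swap else w i

theorem sum_prod_swapBy (F : Z × Z → ℝ) (w : Fin n → Z × Z) :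
    ∑ ε : Fin n → Bool, ∏ i, F (swapBy ε w i) = ∏ i, (F (w i).swap + F (w i)) := by
  have h := Finset.prod_univ_sum (fun _ : Fin n => (Finset.univ : Finset Bool))
    (fun i e => F (if e then (w i).swap else w i))
  simp only [Fintype.piFinset_univ, Fintype.sum_bool, if_true, Bool.false_eq_true, if_false] at h
  exact h.symm

variable [MeasurableSpace Z] (P : Measure Z) [IsProbabilityMeasure P]

theorem measurePreserving_swapBy (ε : Fin n → Bool) :
    MeasurePreserving (swapBy ε) (Measure.pi fun _ : Fin n => P.prod P)
      (Measure.pi fun _ : Fin n => P.prod P) := by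
  refine measurePreserving_pi (f := fun i p => if ε i then Prod.swap p else p) _ _ fun i => ?_
  cases ε i
  · exact MeasurePreserving.id _
  · exact Measure.measurePreserving_swap

/-- Each swap preserves the law of the double sample, so the integral equals that of the average
over swaps, which may be bounded pointwise. -/
theorem lintegral_le_of_sum_swapBy_le {G : (Fin n → Z × Z) → ℝ≥0∞} (hG : Measurable G) {K : ℝ≥0∞}
    (h : ∀ w, ∑ ε : Fin n → Bool, G (swapBy ε w) ≤ 2 ^ n * K) :
    ∫⁻ w, G w ∂(Measure.pi fun _ : Fin n => P.prod P) ≤ K := by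
  have h1 : (2 : ℝ≥0∞) ^ n * ∫⁻ w, G w ∂(Measure.pi fun _ : Fin n => P.prod P) ≤ 2 ^ n * K := by
    calc (2 : ℝ≥0∞) ^ n * ∫⁻ w, G w ∂(Measure.pi fun _ : Fin n => P.prod P)
        = ∑ ε : Fin n → Bool, ∫⁻ w, G (swapBy ε w) ∂(Measure.pi fun _ : Fin n => P.prod P) := by
          simp only [(measurePreserving_swapBy P _).lintegral_comp hG]
          simp
      _ = ∫⁻ w, ∑ ε : Fin n → Bool, G (swapBy ε w) ∂(Measure.pi fun _ : Fin n => P.prod P) :=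
          (lintegral_finsetSum _ fun ε _ =>
            hG.comp (measurePreserving_swapBy P ε).measurable).symm
      _ ≤ ∫⁻ _, 2 ^ n * K ∂(Measure.pi fun _ : Fin n => P.prod P) := lintegral_mono h
      _ = 2 ^ n * K := by simp
  exact (ENNReal.mul_le_mul_iff_right (by simp) (by simp)).1 h1

theorem ofReal_exp_integral_le {X : Z → ℝ} (hX : Measurable X) {K : ℝ} (hK : ∀ z, |X z| ≤ K) :
    ENNReal.ofReal (Real.exp (∫ z, X z ∂P)) ≤ ∫⁻ z, ENNReal.ofReal (Real.exp (X z)) ∂P := by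
  have hXi : Integrable X P := Integrable.of_bound hX.aestronglyMeasurable K (ae_of_all _ hK)
  have hei : Integrable (fun z => Real.exp (X z)) P :=
    Integrable.of_bound (Real.measurable_exp.comp hX).aestronglyMeasurable (Real.exp K)
      (ae_of_all _ fun z => by
        rw [Real.norm_eq_abs, Real.abs_exp]
        exact Real.exp_le_exp.2 ((le_abs_self _).trans (hK z)))
  rw [← ofReal_integral_eq_lintegral_ofReal hei (ae_of_all _ fun z => (Real.exp_pos _).le)]
  exact ENNReal.ofReal_le_ofReal (convexOn_exp.map_integral_le Real.continuous_exp.continuousOn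
    isClosed_univ (ae_of_all _ fun _ => Set.mem_univ _) hXi hei)

end Swap

/-! ### Excess losses -/

section Loss

variable {Z : Type*}

/-- Excess of the square loss of `u` over that of `f₀`. -/
noncomputable def excessLoss (Y f₀ u : Z → ℝ) (z : Z) : ℝ := (Y z - u z) ^ 2 - (Y z - f₀ z) ^ 2

/-- Twice the excess loss with half of the squared distance to `f₀` subtracted. -/
noncomputable def offsetLoss (Y f₀ u : Z → ℝ) (z : Z) : ℝ := 2 * excessLoss Y f₀ u z - (u z - f₀ z) ^ 2 / 2

/-- The offset symmetrized loss on a pair of observations. -/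
noncomputable def pairLoss (Y f₀ u : Z → ℝ) (w : Z × Z) : ℝ :=
  offsetLoss Y f₀ u w.2 - offsetLoss Y f₀ u w.1 -
    ((u w.1 - f₀ w.1) ^ 2 + (u w.2 - f₀ w.2) ^ 2) / 2

/-- The factor `|u - f₀|` is essential: it bounds the square of the loss by the squared distance,
the variance condition behind the fast rate. -/
theorem abs_offsetLoss_le {B : ℝ} {Y f₀ u : Z → ℝ} {z : Z} (hY : |Y z| ≤ B) (hf : |f₀ z| ≤ B)
    (hu : |u z| ≤ B) : |offsetLoss Y f₀ u z| ≤ 9 * B * |u z - f₀ z| := by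
  have h : offsetLoss Y f₀ u z = (2 * (u z + f₀ z - 2 * Y z) - (u z - f₀ z) / 2) * (u z - f₀ z) := by
    unfold offsetLoss excessLoss
    ring
  rw [h, abs_mul]
  refine mul_le_mul_of_nonneg_right ?_ (abs_nonneg _)
  rw [abs_le] at hY hf hu ⊢
  constructor <;> linarith [hY.1, hY.2, hf.1, hf.2, hu.1, hu.2]

theorem abs_offsetLoss_sub_le {B δ : ℝ} {Y f₀ u v : Z → ℝ} {z : Z} (hY : |Y z| ≤ B)
    (hf : |f₀ z| ≤ B) (hu : |u z| ≤ B) (hv : |v z| ≤ B) (huv : |u z - v z| ≤ δ) :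
    |offsetLoss Y f₀ u z - offsetLoss Y f₀ v z| ≤ 10 * B * δ := by
  have h : offsetLoss Y f₀ u z - offsetLoss Y f₀ v z =
      (2 * (u z + v z - 2 * Y z) - (u z + v z - 2 * f₀ z) / 2) * (u z - v z) := by
    unfold offsetLoss excessLoss
    ring
  rw [h, abs_mul]
  refine mul_le_mul ?_ huv (abs_nonneg _) (by linarith [(abs_nonneg (Y z)).trans hY])
  rw [abs_le] at hY hf hu hv ⊢
  constructor <;> linarith [hY.1, hY.2, hf.1, hf.2, hu.1, hu.2, hv.1, hv.2]

theorem abs_sq_sub_sq_le {B δ f u v : ℝ} (hf : |f| ≤ B) (hu : |u| ≤ B) (hv : |v| ≤ B)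
    (huv : |u - v| ≤ δ) : |(u - f) ^ 2 - (v - f) ^ 2| ≤ 4 * B * δ := by
  have h : (u - f) ^ 2 - (v - f) ^ 2 = (u + v - 2 * f) * (u - v) := by ring
  rw [h, abs_mul]
  refine mul_le_mul ?_ huv (abs_nonneg _) (by linarith [(abs_nonneg f).trans hf])
  rw [abs_le] at hf hu hv ⊢
  constructor <;> linarith [hf.1, hf.2, hu.1, hu.2, hv.1, hv.2]

theorem pairLoss_le_add {B δ : ℝ} {Y f₀ u v : Z → ℝ} (hY : ∀ z, |Y z| ≤ B)
    (hf : ∀ z, |f₀ z| ≤ B) (hu : ∀ z, |u z| ≤ B) (hv : ∀ z, |v z| ≤ B) {w : Z × Z}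
    (h1 : |u w.1 - v w.1| ≤ δ) (h2 : |u w.2 - v w.2| ≤ δ) :
    pairLoss Y f₀ u w ≤ pairLoss Y f₀ v w + 24 * B * δ := by
  have a1 := (abs_le.1 (abs_offsetLoss_sub_le (hY w.1) (hf w.1) (hu w.1) (hv w.1) h1)).1
  have a2 := (abs_le.1 (abs_offsetLoss_sub_le (hY w.2) (hf w.2) (hu w.2) (hv w.2) h2)).2
  have a3 := (abs_le.1 (abs_sq_sub_sq_le (hf w.1) (hu w.1) (hv w.1) h1)).1
  have a4 := (abs_le.1 (abs_sq_sub_sq_le (hf w.2) (hu w.2) (hv w.2) h2)).1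
  unfold pairLoss
  linarith

/-- Swapping changes the sign of the difference of losses but not the subtracted squares. The sum is
therefore a `cosh` times a decaying exponential, and the latter wins when `lam` is small compared
with `1 / B ^ 2`. -/
theorem exp_pairLoss_add_exp_pairLoss_swap_le {B lam : ℝ} (hlam : 0 ≤ lam)
    (hlamB : 162 * B ^ 2 * lam ≤ 1) {Y f₀ u : Z → ℝ} (hY : ∀ z, |Y z| ≤ B)
    (hf : ∀ z, |f₀ z| ≤ B) (hu : ∀ z, |u z| ≤ B) (w : Z × Z) :
    Real.exp (lam * pairLoss Y f₀ u w.swap) + Real.exp (lam * pairLoss Y f₀ u w) ≤ 2 := by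
  set p := offsetLoss Y f₀ u w.1
  set q := offsetLoss Y f₀ u w.2
  set s := (u w.1 - f₀ w.1) ^ 2
  set t := (u w.2 - f₀ w.2) ^ 2
  have hp : p ^ 2 ≤ 81 * B ^ 2 * s := by
    have := pow_le_pow_left₀ (abs_nonneg _) (abs_offsetLoss_le (hY w.1) (hf w.1) (hu w.1)) 2
    rw [sq_abs, mul_pow, sq_abs] at this
    linarith
  have hq : q ^ 2 ≤ 81 * B ^ 2 * t := by
    have := pow_le_pow_left₀ (abs_nonneg _) (abs_offsetLoss_le (hY w.2) (hf w.2) (hu w.2)) 2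
    rw [sq_abs, mul_pow, sq_abs] at this
    linarith
  have hst : 0 ≤ s + t := add_nonneg (sq_nonneg _) (sq_nonneg _)
  have h1 : Real.exp (lam * pairLoss Y f₀ u w.swap) + Real.exp (lam * pairLoss Y f₀ u w) =
      2 * (Real.cosh (lam * (q - p)) * Real.exp (-(lam * ((s + t) / 2)))) := by
    rw [Real.cosh_eq, div_mul_eq_mul_div, mul_div_cancel₀ _ two_ne_zero, add_mul, ← Real.exp_add,
      ← Real.exp_add, add_comm]
    simp only [pairLoss, Prod.fst_swap, Prod.snd_swap]
    congr 2 <;> ring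
  have h2 : Real.cosh (lam * (q - p)) * Real.exp (-(lam * ((s + t) / 2))) ≤ 1 := by
    calc Real.cosh (lam * (q - p)) * Real.exp (-(lam * ((s + t) / 2)))
        ≤ Real.exp ((lam * (q - p)) ^ 2 / 2) * Real.exp (-(lam * ((s + t) / 2))) :=
          mul_le_mul_of_nonneg_right (Real.cosh_le_exp_half_sq _) (Real.exp_pos _).le
      _ ≤ 1 := by
          rw [← Real.exp_add, Real.exp_le_one_iff]
          have h3 : (q - p) ^ 2 ≤ 162 * B ^ 2 * (s + t) := by nlinarith [sq_nonneg (p + q)]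
          have h4 : lam * (lam * (q - p) ^ 2) ≤ lam * (s + t) := by
            refine mul_le_mul_of_nonneg_left ?_ hlam
            calc lam * (q - p) ^ 2 ≤ lam * (162 * B ^ 2 * (s + t)) :=
                  mul_le_mul_of_nonneg_left h3 hlam
              _ = (162 * B ^ 2 * lam) * (s + t) := by ring
              _ ≤ s + t := mul_le_of_le_one_left hst hlamB
          nlinarith
  linarith

theorem sum_exp_pairLoss_swapBy_le {B lam : ℝ} (hlam : 0 ≤ lam)
    (hlamB : 162 * B ^ 2 * lam ≤ 1) {Y f₀ u : Z → ℝ} (hY : ∀ z, |Y z| ≤ B)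
    (hf : ∀ z, |f₀ z| ≤ B) (hu : ∀ z, |u z| ≤ B) {n : ℕ} (w : Fin n → Z × Z) :
    ∑ ε : Fin n → Bool, Real.exp (lam * ∑ i, pairLoss Y f₀ u (swapBy ε w i)) ≤ 2 ^ n := by
  have h := sum_prod_swapBy (fun p => Real.exp (lam * pairLoss Y f₀ u p)) w
  simp only [← Real.exp_sum, ← Finset.mul_sum] at h
  rw [h]
  calc _ ≤ ∏ _i : Fin n, (2 : ℝ) := Finset.prod_le_prod
        (fun i _ => (add_pos (Real.exp_pos _) (Real.exp_pos _)).le)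
        fun i _ => exp_pairLoss_add_exp_pairLoss_swap_le hlam hlamB hY hf hu (w i)
    _ = 2 ^ n := by simp

end Loss

/-! ### Truncated linear combinations of dictionary elements -/

section Class

variable {Z ι : Type*}

/-- The truncated linear combination `T_B (∑ c_l g_{s l})`. -/
noncomputable def truncComb (B : ℝ) (g : ι → Z → ℝ) {k : ℕ} (s : Fin k → ι) (c : Fin k → ℝ) (z : Z) : ℝ :=
  truncation B (∑ l, c l * g (s l) z)

/-- A union bound over the cover: every member averages to at most 1, and passing to the nearest
member costs one factor `exp 1`. -/
theorem sum_iSup_exp_pairLoss_le {B b lam : ℝ} (hB : 0 ≤ B) (hBb : B ≤ b) (hb : 0 < b)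
    (hlam : 0 ≤ lam) (hlamb : 162 * b ^ 2 * lam ≤ 1) {Y f₀ : Z → ℝ} (hY : ∀ z, |Y z| ≤ B)
    (hf : ∀ z, |f₀ z| ≤ B) (g : ι → Z → ℝ) {k n : ℕ} (hn : 0 < n) (s : Fin k → ι)
    (w : Fin n → Z × Z) :
    ∑ ε : Fin n → Bool, ⨆ c : Fin k → ℝ,
      ENNReal.ofReal (Real.exp (lam * ∑ i, pairLoss Y f₀ (truncComb B g s c) (swapBy ε w i))) ≤
        2 ^ n * ((((n * 2) * (n + 1) + 1) ^ (k + 1) : ℕ) * ENNReal.ofReal (Real.exp 1)) := by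
  have hn' : (0 : ℝ) < n := by exact_mod_cast hn
  -- The cover controls both entries of every pair, so the same finite set serves all `2 ^ n` swaps.
  obtain ⟨C, hC, hcov⟩ := exists_truncation_cover hB hBb hb hn
    (fun (p : Fin n × Bool) (l : Fin k) => g (s l) (if p.2 then (w p.1).1 else (w p.1).2))
  have hT : ∀ (c : Fin k → ℝ) z, |truncComb B g s c z| ≤ B := fun c z => abs_truncation_le hB _
  have hlamB : 162 * B ^ 2 * lam ≤ 1 := by
    refine le_trans (mul_le_mul_of_nonneg_right ?_ hlam) hlamb
    nlinarith
  have hpt : ∀ (ε : Fin n → Bool) (c : Fin k → ℝ), ENNReal.ofReal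
      (Real.exp (lam * ∑ i, pairLoss Y f₀ (truncComb B g s c) (swapBy ε w i))) ≤
      ∑ c' ∈ C, ENNReal.ofReal
        (Real.exp (lam * ∑ i, pairLoss Y f₀ (truncComb B g s c') (swapBy ε w i))) *
          ENNReal.ofReal (Real.exp 1) := fun ε c => by
    obtain ⟨c', hc', hcc'⟩ := hcov c
    refine le_trans ?_ (Finset.single_le_sum (f := fun c' => ENNReal.ofReal
        (Real.exp (lam * ∑ i, pairLoss Y f₀ (truncComb B g s c') (swapBy ε w i))) *
          ENNReal.ofReal (Real.exp 1)) (fun _ _ => zero_le) hc')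
    rw [← ENNReal.ofReal_mul (Real.exp_pos _).le, ← Real.exp_add]
    refine ENNReal.ofReal_le_ofReal (Real.exp_le_exp.2 ?_)
    have hone : ∀ i, pairLoss Y f₀ (truncComb B g s c) (swapBy ε w i) ≤
        pairLoss Y f₀ (truncComb B g s c') (swapBy ε w i) + 24 * B * (2 * b / n) := fun i => by
      have h1 := hcc' (i, true)
      have h2 := hcc' (i, false)
      simp only [if_true, Bool.false_eq_true, if_false] at h1 h2
      refine pairLoss_le_add hY hf (hT c) (hT c') ?_ ?_ <;> unfold swapBy <;> split_ifs <;>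
        assumption
    have hsum := Finset.sum_le_sum fun i (_ : i ∈ Finset.univ) => hone i
    rw [Finset.sum_add_distrib, Finset.sum_const, Finset.card_univ, Fintype.card_fin,
      nsmul_eq_mul] at hsum
    have hval : (n : ℝ) * (24 * B * (2 * b / n)) = 48 * (B * b) := by field_simp; ring
    rw [hval] at hsum
    have h3 := mul_le_mul_of_nonneg_left hsum hlam
    have h4 : lam * (48 * (B * b)) ≤ 1 := by nlinarith [mul_le_mul_of_nonneg_left hBb hb.le]
    linarith
  calc _ ≤ ∑ ε : Fin n → Bool, ∑ c' ∈ C, ENNReal.ofReal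
        (Real.exp (lam * ∑ i, pairLoss Y f₀ (truncComb B g s c') (swapBy ε w i))) *
          ENNReal.ofReal (Real.exp 1) :=
        Finset.sum_le_sum fun ε _ => iSup_le fun c => hpt ε c
    _ = ∑ c' ∈ C, (∑ ε : Fin n → Bool, ENNReal.ofReal
        (Real.exp (lam * ∑ i, pairLoss Y f₀ (truncComb B g s c') (swapBy ε w i)))) *
          ENNReal.ofReal (Real.exp 1) := by
        rw [Finset.sum_comm]
        simp only [Finset.sum_mul]
    _ ≤ ∑ _c' ∈ C, 2 ^ n * ENNReal.ofReal (Real.exp 1) := by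
        refine Finset.sum_le_sum fun c' _ => mul_le_mul_left ?_ _
        rw [← ENNReal.ofReal_sum_of_nonneg fun _ _ => (Real.exp_pos _).le]
        refine (ENNReal.ofReal_le_ofReal
          (sum_exp_pairLoss_swapBy_le hlam hlamB hY hf (hT c') w)).trans ?_
        rw [ENNReal.ofReal_pow (by norm_num)]
        simp
    _ = 2 ^ n * (C.card * ENNReal.ofReal (Real.exp 1)) := by
        rw [Finset.sum_const, nsmul_eq_mul]
        ring
    _ ≤ _ := by
        gcongr
        simpa using hC

end Class

/-! ### Exponential deviation inequality, uniform over truncated combinations -/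

section Deviation

variable {Z : Type*} [MeasurableSpace Z] (P : Measure Z)

/-- The squared distance of `u` to `f₀`. -/
noncomputable def sqDist (f₀ u : Z → ℝ) : ℝ := ∫ z, (u z - f₀ z) ^ 2 ∂P

/-- `f₀` is a bounded regression function of the bounded variable `Y` with respect to the
variables on which the functions in `g` depend. -/
structure IsRegression {ι : Type*} (B : ℝ) (Y f₀ : Z → ℝ) (g : ι → Z → ℝ) : Prop where
  nonneg : 0 ≤ B
  measurable_Y : Measurable Y
  measurable_f₀ : Measurable f₀
  measurable_g : ∀ i, Measurable (g i)
  abs_Y_le : ∀ z, |Y z| ≤ B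
  abs_f₀_le : ∀ z, |f₀ z| ≤ B
  orthogonal : ∀ (k : ℕ) (s : Fin k → ι) (c : Fin k → ℝ),
    ∫ z, (Y z - f₀ z) * (truncComb B g s c z - f₀ z) ∂P = 0

namespace IsRegression

variable {P} {ι : Type*} {B : ℝ} {Y f₀ : Z → ℝ} {g : ι → Z → ℝ} (H : IsRegression P B Y f₀ g)
include H

theorem abs_truncComb_le {k : ℕ} (s : Fin k → ι) (c : Fin k → ℝ) (z : Z) :
    |truncComb B g s c z| ≤ B := abs_truncation_le H.nonneg _

theorem measurable_truncComb {k : ℕ} (s : Fin k → ι) (c : Fin k → ℝ) :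
    Measurable (truncComb B g s c) :=
  (continuous_truncation H.nonneg).measurable.comp
    (Finset.measurable_sum _ fun l _ => (H.measurable_g (s l)).const_mul _)

theorem measurable_excessLoss {k : ℕ} (s : Fin k → ι) (c : Fin k → ℝ) :
    Measurable (excessLoss Y f₀ (truncComb B g s c)) := by
  have h1 := H.measurable_truncComb s c
  have h2 := H.measurable_Y
  have h3 := H.measurable_f₀
  unfold excessLoss
  fun_prop

theorem measurable_offsetLoss {k : ℕ} (s : Fin k → ι) (c : Fin k → ℝ) :
    Measurable (offsetLoss Y f₀ (truncComb B g s c)) := by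
  have h1 := H.measurable_truncComb s c
  have h3 := H.measurable_f₀
  have h4 := H.measurable_excessLoss s c
  unfold offsetLoss
  fun_prop

theorem measurable_pairLoss {k : ℕ} (s : Fin k → ι) (c : Fin k → ℝ) :
    Measurable (pairLoss Y f₀ (truncComb B g s c)) := by
  have h1 := H.measurable_truncComb s c
  have h3 := H.measurable_f₀
  have h4 := H.measurable_offsetLoss s c
  unfold pairLoss
  fun_prop

theorem abs_sub_le {k : ℕ} (s : Fin k → ι) (c : Fin k → ℝ) (z : Z) :
    |truncComb B g s c z - f₀ z| ≤ 2 * B := by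
  have h1 := abs_le.1 (H.abs_truncComb_le s c z)
  have h2 := abs_le.1 (H.abs_f₀_le z)
  rw [abs_le]
  constructor <;> linarith [h1.1, h1.2, h2.1, h2.2]

theorem sq_sub_le {k : ℕ} (s : Fin k → ι) (c : Fin k → ℝ) (z : Z) :
    (truncComb B g s c z - f₀ z) ^ 2 ≤ 4 * B ^ 2 := by
  rw [← sq_abs]
  have := pow_le_pow_left₀ (abs_nonneg _) (H.abs_sub_le s c z) 2
  linarith

theorem abs_offsetLoss_le' {k : ℕ} (s : Fin k → ι) (c : Fin k → ℝ) (z : Z) :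
    |offsetLoss Y f₀ (truncComb B g s c) z| ≤ 18 * B ^ 2 := by
  have h1 := abs_offsetLoss_le (H.abs_Y_le z) (H.abs_f₀_le z) (H.abs_truncComb_le s c z)
  have h2 := mul_le_mul_of_nonneg_left (H.abs_sub_le s c z) (by linarith [H.nonneg] : 0 ≤ 9 * B)
  linarith

theorem abs_pairLoss_le {k : ℕ} (s : Fin k → ι) (c : Fin k → ℝ) (w : Z × Z) :
    |pairLoss Y f₀ (truncComb B g s c) w| ≤ 40 * B ^ 2 := by
  have h1 := abs_le.1 (H.abs_offsetLoss_le' s c w.1)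
  have h2 := abs_le.1 (H.abs_offsetLoss_le' s c w.2)
  have h3 := H.sq_sub_le s c w.1
  have h4 := H.sq_sub_le s c w.2
  have h5 := sq_nonneg (truncComb B g s c w.1 - f₀ w.1)
  have h6 := sq_nonneg (truncComb B g s c w.2 - f₀ w.2)
  unfold pairLoss
  rw [abs_le]
  constructor <;> linarith [h1.1, h1.2, h2.1, h2.2]

theorem integrable_sq_sub [IsProbabilityMeasure P] {k : ℕ} (s : Fin k → ι) (c : Fin k → ℝ) :
    Integrable (fun z => (truncComb B g s c z - f₀ z) ^ 2) P :=
  Integrable.of_bound (((H.measurable_truncComb s c).sub H.measurable_f₀).pow_const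
    2).aestronglyMeasurable (4 * B ^ 2) (ae_of_all _ fun z => by
      rw [Real.norm_eq_abs, abs_of_nonneg (sq_nonneg _)]
      exact H.sq_sub_le s c z)

theorem integrable_offsetLoss [IsProbabilityMeasure P] {k : ℕ} (s : Fin k → ι) (c : Fin k → ℝ) :
    Integrable (offsetLoss Y f₀ (truncComb B g s c)) P :=
  Integrable.of_bound (H.measurable_offsetLoss s c).aestronglyMeasurable (18 * B ^ 2)
    (ae_of_all _ fun z => H.abs_offsetLoss_le' s c z)

theorem integral_offsetLoss [IsProbabilityMeasure P] {k : ℕ} (s : Fin k → ι) (c : Fin k → ℝ) :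
    ∫ z, offsetLoss Y f₀ (truncComb B g s c) z ∂P = 3 / 2 * sqDist P f₀ (truncComb B g s c) := by
  have h : ∀ z, offsetLoss Y f₀ (truncComb B g s c) z =
      3 / 2 * (truncComb B g s c z - f₀ z) ^ 2 -
        4 * ((Y z - f₀ z) * (truncComb B g s c z - f₀ z)) := fun z => by
    unfold offsetLoss excessLoss
    ring
  have hi : Integrable (fun z => 4 * ((Y z - f₀ z) * (truncComb B g s c z - f₀ z))) P := by
    have := ((H.integrable_sq_sub s c).const_mul (3 / 2)).sub (H.integrable_offsetLoss s c)
    refine this.congr (ae_of_all _ fun z => ?_)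
    simp only [Pi.sub_apply, h z]
    ring
  simp only [h]
  rw [integral_sub ((H.integrable_sq_sub s c).const_mul _) hi, integral_const_mul,
    integral_const_mul, H.orthogonal, mul_zero, sub_zero, sqDist]

theorem integral_pairLoss [IsProbabilityMeasure P] {k : ℕ} (s : Fin k → ι) (c : Fin k → ℝ) (z : Z) :
    ∫ z', pairLoss Y f₀ (truncComb B g s c) (z, z') ∂P =
      sqDist P f₀ (truncComb B g s c) - 2 * excessLoss Y f₀ (truncComb B g s c) z := by
  have hi := H.integrable_offsetLoss s c
  have hj := H.integrable_sq_sub s c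
  have h : ∀ z', pairLoss Y f₀ (truncComb B g s c) (z, z') =
      (offsetLoss Y f₀ (truncComb B g s c) z' - (truncComb B g s c z' - f₀ z') ^ 2 / 2) -
        (offsetLoss Y f₀ (truncComb B g s c) z + (truncComb B g s c z - f₀ z) ^ 2 / 2) :=
    fun z' => by
      unfold pairLoss
      ring
  have hij : Integrable (fun z' => offsetLoss Y f₀ (truncComb B g s c) z' -
      (truncComb B g s c z' - f₀ z') ^ 2 / 2) P := hi.sub (hj.div_const 2)
  simp only [h]
  rw [integral_sub hij (integrable_const _),
    integral_sub hi (hj.div_const 2), integral_div, H.integral_offsetLoss]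
  simp only [integral_const, probReal_univ, one_smul]
  rw [offsetLoss, sqDist]
  ring

/-- Jensen's inequality for the ghost sample. -/
theorem ofReal_exp_sum_le [IsProbabilityMeasure P] {k : ℕ} (s : Fin k → ι) (c : Fin k → ℝ) {n : ℕ} (lam : ℝ)
    (z : Fin n → Z) :
    ENNReal.ofReal (Real.exp (lam * ∑ j, (sqDist P f₀ (truncComb B g s c) -
      2 * excessLoss Y f₀ (truncComb B g s c) (z j)))) ≤
    ∫⁻ z', ENNReal.ofReal (Real.exp (lam * ∑ j, pairLoss Y f₀ (truncComb B g s c) (z j, z' j)))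
      ∂(Measure.pi fun _ : Fin n => P) := by
  have hm : ∀ j, Measurable fun y => pairLoss Y f₀ (truncComb B g s c) (z j, y) := fun j =>
    (H.measurable_pairLoss s c).comp measurable_prodMk_left
  have hint : ∀ j, Integrable (fun z' : Fin n → Z => pairLoss Y f₀ (truncComb B g s c)
      (z j, z' j)) (Measure.pi fun _ : Fin n => P) := fun j =>
    Integrable.of_bound ((hm j).comp (measurable_pi_apply j)).aestronglyMeasurable (40 * B ^ 2)
      (ae_of_all _ fun z' => H.abs_pairLoss_le s c _)
  have heq : ∫ z', lam * ∑ j, pairLoss Y f₀ (truncComb B g s c) (z j, z' j)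
      ∂(Measure.pi fun _ : Fin n => P) = lam * ∑ j, (sqDist P f₀ (truncComb B g s c) -
      2 * excessLoss Y f₀ (truncComb B g s c) (z j)) := by
    rw [integral_const_mul, integral_finsetSum _ fun j _ => hint j]
    congr 1
    refine Finset.sum_congr rfl fun j _ => ?_
    rw [← H.integral_pairLoss]
    exact integral_comp_eval (μ := fun _ : Fin n => P) (i := j)
      (f := fun y => pairLoss Y f₀ (truncComb B g s c) (z j, y)) (hm j).aestronglyMeasurable
  rw [← heq]
  refine ofReal_exp_integral_le _ (K := |lam| * ∑ _j : Fin n, 40 * B ^ 2)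
    ((Finset.measurable_sum _ fun j _ => (hm j).comp (measurable_pi_apply j)).const_mul _)
    fun z' => ?_
  rw [abs_mul]
  exact mul_le_mul_of_nonneg_left ((Finset.abs_sum_le_sum_abs _ _).trans
    (Finset.sum_le_sum fun j _ => H.abs_pairLoss_le s c _)) (abs_nonneg _)

end IsRegression

/-- The largest exponential of the penalized deviation between risk and twice the empirical risk
over the truncated rational combinations of the functions in `g`. -/
noncomputable def expDeviation {ι : Type*} (B lam A : ℝ) (Y f₀ : Z → ℝ) (g : ι → Z → ℝ) {n : ℕ}
    (z : Fin n → Z) : ℝ≥0∞ :=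
  ⨆ i : Σ k : ℕ, (Fin (k + 1) → ι) × (Fin (k + 1) → ℚ),
    ENNReal.ofReal (Real.exp (lam * ∑ j, (sqDist P f₀ (truncComb B g i.2.1 fun l => i.2.2 l) -
      2 * excessLoss Y f₀ (truncComb B g i.2.1 fun l => i.2.2 l) (z j)) -
        A * ((i.1 + 1 : ℕ) * Real.log n)))

variable {ι : Type*} {B : ℝ} {Y f₀ : Z → ℝ} {g : ι → Z → ℝ}

theorem IsRegression.measurable_expDeviation [Countable ι] {P} (H : IsRegression P B Y f₀ g)
    (lam A : ℝ) (n : ℕ) :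
    Measurable (expDeviation P B lam A Y f₀ g (n := n)) := by
  refine Measurable.iSup fun i => ENNReal.measurable_ofReal.comp (Real.measurable_exp.comp ?_)
  refine ((Finset.measurable_sum _ fun j _ => ?_).const_mul _).sub_const _
  exact (((H.measurable_excessLoss _ _).comp (measurable_pi_apply j)).const_mul _).const_sub _

/-- The constant 11 is chosen here: the cover costs at most `n ^ (5 (k + 2))` and `5 (k + 2) ≤ 10 (k
+ 1)`, while one further power `n ^ (-(k + 1))` remains and makes the sum over `k` geometric. -/
theorem pow_mul_pow_mul_exp_le {a : ℝ} {n M : ℕ} (hn : 2 ≤ n) (hM : (M : ℝ) ≤ (n : ℝ) ^ a)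
    (k : ℕ) :
    (M : ℝ) ^ (k + 1) * ((n : ℝ) * 2 * (n + 1) + 1) ^ (k + 2) *
      Real.exp (-((a + 11) * ((k + 1 : ℕ) * Real.log n))) ≤ (1 / 2) ^ (k + 1) := by
  have hn2 : (2 : ℝ) ≤ n := by exact_mod_cast hn
  have hn0 : (0 : ℝ) < n := by linarith
  have hlog : 0 ≤ Real.log n := Real.log_nonneg (by linarith)
  have h1 : (M : ℝ) ^ (k + 1) ≤ Real.exp ((k + 1 : ℕ) * (Real.log n * a)) := by
    rw [Real.exp_nat_mul, ← Real.rpow_def_of_pos hn0]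
    exact pow_le_pow_left₀ (Nat.cast_nonneg _) hM _
  have h2 : ((n : ℝ) * 2 * (n + 1) + 1) ^ (k + 2) ≤
      Real.exp ((k + 2 : ℕ) * ((5 : ℕ) * Real.log n)) := by
    rw [Real.exp_nat_mul, Real.exp_nat_mul, Real.exp_log hn0]
    refine pow_le_pow_left₀ (by positivity) ?_ _
    have h3 : (8 : ℝ) ≤ (n : ℝ) ^ 3 := by nlinarith [mul_nonneg hn0.le (sub_nonneg.2 hn2)]
    have h4 : (n : ℝ) ^ 2 * 8 ≤ (n : ℝ) ^ 2 * (n : ℝ) ^ 3 :=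
      mul_le_mul_of_nonneg_left h3 (sq_nonneg _)
    nlinarith
  calc _ ≤ Real.exp ((k + 1 : ℕ) * (Real.log n * a)) *
        Real.exp ((k + 2 : ℕ) * ((5 : ℕ) * Real.log n)) *
          Real.exp (-((a + 11) * ((k + 1 : ℕ) * Real.log n))) := by gcongr
    _ = Real.exp (-((k + 1 : ℕ) * Real.log n) - 5 * k * Real.log n) := by
        rw [← Real.exp_add, ← Real.exp_add]
        congr 1
        push_cast
        ring
    _ ≤ Real.exp ((k + 1 : ℕ) * -Real.log n) := by
        refine Real.exp_le_exp.2 ?_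
        have : 0 ≤ 5 * (k : ℝ) * Real.log n := by positivity
        linarith
    _ = (1 / (n : ℝ)) ^ (k + 1) := by
        rw [Real.exp_nat_mul, Real.exp_neg, Real.exp_log hn0, one_div]
    _ ≤ _ := by gcongr

theorem IsRegression.lintegral_expDeviation_le [Fintype ι] {P} [IsProbabilityMeasure P]
    (H : IsRegression P B Y f₀ g)
    {b lam a : ℝ} (hBb : B ≤ b) (hb : 0 < b) (hlam : 0 ≤ lam) (hlamb : 162 * b ^ 2 * lam ≤ 1)
    {n : ℕ} (hn : 2 ≤ n) (hcard : (Fintype.card ι : ℝ) ≤ (n : ℝ) ^ a) :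
    ∫⁻ z, expDeviation P B lam (a + 11) Y f₀ g z ∂(Measure.pi fun _ : Fin n => P) ≤
      ENNReal.ofReal (Real.exp 1) := by
  set q : ℕ → ℝ≥0∞ := fun k =>
    ENNReal.ofReal (Real.exp (-((a + 11) * ((k + 1 : ℕ) * Real.log n)))) with hq
  set G : (Fin n → Z × Z) → ℝ≥0∞ := fun w =>
    ⨆ i : Σ k : ℕ, (Fin (k + 1) → ι) × (Fin (k + 1) → ℚ), ENNReal.ofReal (Real.exp
      (lam * ∑ j, pairLoss Y f₀ (truncComb B g i.2.1 fun l => i.2.2 l) (w j))) * q i.1 with hG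
  have hGm : Measurable G := by
    refine Measurable.iSup fun i => (ENNReal.measurable_ofReal.comp
      (Real.measurable_exp.comp ?_)).mul_const _
    refine (Finset.measurable_sum _ fun j _ => ?_).const_mul _
    exact (H.measurable_pairLoss _ _).comp (measurable_pi_apply j)
  have h1 : ∀ z : Fin n → Z, expDeviation P B lam (a + 11) Y f₀ g z ≤
      ∫⁻ z' : Fin n → Z, G (fun j => (z j, z' j)) ∂(Measure.pi fun _ : Fin n => P) := fun z => by
    refine iSup_le fun i => ?_
    rw [sub_eq_add_neg, Real.exp_add, ENNReal.ofReal_mul (Real.exp_pos _).le]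
    refine (mul_le_mul_left (H.ofReal_exp_sum_le i.2.1 (fun l => i.2.2 l) lam z) _).trans ?_
    rw [← lintegral_mul_const' _ _ ENNReal.ofReal_ne_top]
    refine lintegral_mono fun z' => ?_
    exact le_iSup (fun i : Σ k : ℕ, (Fin (k + 1) → ι) × (Fin (k + 1) → ℚ) => ENNReal.ofReal
      (Real.exp (lam * ∑ j, pairLoss Y f₀ (truncComb B g i.2.1 fun l => i.2.2 l)
        (z j, z' j))) * q i.1) i
  have h2 : ∀ w, ∑ ε : Fin n → Bool, G (swapBy ε w) ≤ 2 ^ n * ENNReal.ofReal (Real.exp 1) := by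
    intro w
    -- The suprema over `k` and over the selected elements are replaced by sums; only the supremum
    -- over coefficients, enlarged from rational to real, is left to the cover.
    calc ∑ ε : Fin n → Bool, G (swapBy ε w)
        ≤ ∑ ε : Fin n → Bool, ∑' k : ℕ, ∑ s : Fin (k + 1) → ι, (⨆ c : Fin (k + 1) → ℝ,
            ENNReal.ofReal (Real.exp (lam * ∑ j, pairLoss Y f₀ (truncComb B g s c)
              (swapBy ε w j)))) * q k := by
          refine Finset.sum_le_sum fun ε _ => iSup_le fun i => ?_
          obtain ⟨k, s, c⟩ := i
          refine le_trans ?_ (ENNReal.le_tsum k)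
          refine le_trans ?_ (Finset.single_le_sum (f := fun s : Fin (k + 1) → ι =>
            (⨆ c : Fin (k + 1) → ℝ, ENNReal.ofReal (Real.exp (lam * ∑ j, pairLoss Y f₀
              (truncComb B g s c) (swapBy ε w j)))) * q k) (fun _ _ => zero_le)
                (Finset.mem_univ s))
          exact mul_le_mul_left (le_iSup (fun c : Fin (k + 1) → ℝ => ENNReal.ofReal (Real.exp
            (lam * ∑ j, pairLoss Y f₀ (truncComb B g s c) (swapBy ε w j)))) fun l => (c l : ℝ)) _
      _ = ∑' k : ℕ, ∑ s : Fin (k + 1) → ι, (∑ ε : Fin n → Bool, ⨆ c : Fin (k + 1) → ℝ,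
            ENNReal.ofReal (Real.exp (lam * ∑ j, pairLoss Y f₀ (truncComb B g s c)
              (swapBy ε w j)))) * q k := by
          rw [← Summable.tsum_finsetSum fun _ _ => ENNReal.summable]
          refine tsum_congr fun k => ?_
          rw [Finset.sum_comm]
          simp only [Finset.sum_mul]
      _ ≤ ∑' k : ℕ, (2 ^ n * ENNReal.ofReal (Real.exp 1)) * (2⁻¹ : ℝ≥0∞) ^ (k + 1) := by
          refine ENNReal.tsum_le_tsum fun k => ?_
          have h3 := fun s : Fin (k + 1) → ι => sum_iSup_exp_pairLoss_le H.nonneg hBb hb hlam hlamb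
            H.abs_Y_le H.abs_f₀_le g (by omega : 0 < n) s w
          refine (Finset.sum_le_sum fun s _ => mul_le_mul_left (h3 s) _).trans ?_
          rw [Finset.sum_const, Finset.card_univ, Fintype.card_fun, Fintype.card_fin, nsmul_eq_mul]
          have h4 : (((Fintype.card ι) ^ (k + 1) : ℕ) : ℝ≥0∞) *
              ((((n * 2) * (n + 1) + 1) ^ (k + 1 + 1) : ℕ)) * q k ≤ (2⁻¹ : ℝ≥0∞) ^ (k + 1) := by
            have h5 := ENNReal.ofReal_le_ofReal (pow_mul_pow_mul_exp_le hn hcard k)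
            rw [ENNReal.ofReal_mul (by positivity), ENNReal.ofReal_mul (by positivity),
              ENNReal.ofReal_pow (by norm_num)] at h5
            convert h5 using 2
            · rw [← ENNReal.ofReal_natCast, ← ENNReal.ofReal_natCast]
              push_cast
              rw [ENNReal.ofReal_pow (Nat.cast_nonneg _)]
            · rw [ENNReal.ofReal_pow (by norm_num), one_div, ENNReal.ofReal_inv_of_pos two_pos]
              simp
          calc _ = (2 ^ n * ENNReal.ofReal (Real.exp 1)) * ((((Fintype.card ι) ^ (k + 1) : ℕ) :
                ℝ≥0∞) * ((((n * 2) * (n + 1) + 1) ^ (k + 1 + 1) : ℕ)) * q k) := by ring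
            _ ≤ _ := mul_le_mul_right h4 _
      _ = 2 ^ n * ENNReal.ofReal (Real.exp 1) := by
          rw [ENNReal.tsum_mul_left]
          simp only [pow_succ]
          rw [ENNReal.tsum_mul_right, ENNReal.tsum_geometric, ENNReal.one_sub_inv_two, inv_inv,
            ENNReal.mul_inv_cancel two_ne_zero ENNReal.ofNat_ne_top, mul_one]
  -- Two independent samples form one sample of independent pairs.
  have h5 : ∫⁻ z, ∫⁻ z', G (fun j => (z j, z' j)) ∂(Measure.pi fun _ : Fin n => P)
      ∂(Measure.pi fun _ : Fin n => P) = ∫⁻ w, G w ∂(Measure.pi fun _ : Fin n => P.prod P) := by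
    have hmp := measurePreserving_arrowProdEquivProdArrow Z Z (Fin n) (fun _ => P) fun _ => P
    have hm : Measurable fun p : (Fin n → Z) × (Fin n → Z) => G fun j => (p.1 j, p.2 j) :=
      hGm.comp (by fun_prop)
    rw [← lintegral_prod _ hm.aemeasurable, ← hmp.lintegral_comp hm]
    rfl
  calc _ ≤ _ := lintegral_mono h1
    _ = _ := h5
    _ ≤ _ := lintegral_le_of_sum_swapBy_le P hGm h2

theorem IsRegression.continuous_sqDist {P} [IsProbabilityMeasure P] (H : IsRegression P B Y f₀ g)
    {k : ℕ} (s : Fin k → ι) : Continuous fun c => sqDist P f₀ (truncComb B g s c) := by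
  refine continuous_of_dominated (bound := fun _ => 4 * B ^ 2)
    (fun c => (H.integrable_sq_sub s c).aestronglyMeasurable)
    (fun c => ae_of_all _ fun z => ?_) (integrable_const _) (ae_of_all _ fun z => ?_)
  · rw [Real.norm_eq_abs, abs_of_nonneg (sq_nonneg _)]
    exact H.sq_sub_le s c z
  · exact (((continuous_truncation H.nonneg).comp (by fun_prop)).sub continuous_const).pow 2

/-- Rational coefficients keep the supremum countable, hence measurable; continuity in the
coefficients recovers the real ones that the algorithm produces. -/
theorem IsRegression.ofReal_exp_le_expDeviation {P} [IsProbabilityMeasure P]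
    (H : IsRegression P B Y f₀ g) (lam A : ℝ)
    {n k : ℕ} (hk : 0 < k) (s : Fin k → ι) (c : Fin k → ℝ) (z : Fin n → Z) :
    ENNReal.ofReal (Real.exp (lam * ∑ j, (sqDist P f₀ (truncComb B g s c) -
      2 * excessLoss Y f₀ (truncComb B g s c) (z j)) - A * (k * Real.log n))) ≤
        expDeviation P B lam A Y f₀ g z := by
  obtain ⟨k, rfl⟩ := Nat.exists_eq_add_one.2 hk
  have hd : DenseRange (Pi.map fun (_ : Fin (k + 1)) (q : ℚ) => (q : ℝ)) :=
    DenseRange.piMap fun _ => Rat.denseRange_cast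
  refine hd.induction_on (p := fun c => ENNReal.ofReal (Real.exp (lam * ∑ j, (sqDist P f₀
    (truncComb B g s c) - 2 * excessLoss Y f₀ (truncComb B g s c) (z j)) -
      A * ((k + 1 : ℕ) * Real.log n))) ≤ expDeviation P B lam A Y f₀ g z) c ?_ fun q => ?_
  · refine isClosed_le (ENNReal.continuous_ofReal.comp (Real.continuous_exp.comp ?_))
      continuous_const
    refine (continuous_const.mul (continuous_finsetSum _ fun j _ => ?_)).sub continuous_const
    refine (H.continuous_sqDist s).sub (continuous_const.mul ?_)
    refine ((continuous_const.sub ?_).pow 2).sub continuous_const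
    exact (continuous_truncation H.nonneg).comp (by fun_prop)
  · exact le_iSup (fun i : Σ k : ℕ, (Fin (k + 1) → ι) × (Fin (k + 1) → ℚ) =>
      ENNReal.ofReal (Real.exp (lam * ∑ j, (sqDist P f₀ (truncComb B g i.2.1 fun l => i.2.2 l) -
      2 * excessLoss Y f₀ (truncComb B g i.2.1 fun l => i.2.2 l) (z j)) -
        A * ((i.1 + 1 : ℕ) * Real.log n)))) ⟨k, s, q⟩

end Deviation

/-! ### The empirical inner product -/

section EmpInner

variable {n : ℕ} (u v w : Fin n → ℝ) (r : ℝ)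

theorem empInner_comm : empInner u v = empInner v u := by
  simp only [empInner, mul_comm]

theorem empInner_add_left : empInner (u + v) w = empInner u w + empInner v w := by
  simp only [empInner, Pi.add_apply, add_mul, Finset.sum_add_distrib, mul_add]

theorem empInner_smul_left : empInner (r • u) v = r * empInner u v := by
  simp only [empInner, Pi.smul_apply, smul_eq_mul, Finset.mul_sum]
  exact Finset.sum_congr rfl fun i _ => by ring

theorem empInner_sub_left : empInner (u - v) w = empInner u w - empInner v w := by
  rw [sub_eq_add_neg, ← neg_one_smul ℝ v, empInner_add_left, empInner_smul_left]
  ring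

theorem empInner_add_right : empInner u (v + w) = empInner u v + empInner u w := by
  rw [empInner_comm, empInner_add_left, empInner_comm v, empInner_comm w]

theorem empInner_sub_right : empInner u (v - w) = empInner u v - empInner u w := by
  rw [empInner_comm, empInner_sub_left, empInner_comm v, empInner_comm w]

theorem empInner_smul_right : empInner u (r • v) = r * empInner u v := by
  rw [empInner_comm, empInner_smul_left, empInner_comm]

theorem empInner_sum_right {N : ℕ} (v : Fin N → Fin n → ℝ) :
    empInner u (∑ i, v i) = ∑ i, empInner u (v i) := by
  simp only [empInner, Finset.sum_apply, Finset.mul_sum]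
  rw [Finset.sum_comm]

theorem empInner_self_nonneg : 0 ≤ empInner u u :=
  mul_nonneg (by positivity) (Finset.sum_nonneg fun _ _ => mul_self_nonneg _)

theorem empNorm_sq : empNorm u ^ 2 = empInner u u := Real.sq_sqrt (empInner_self_nonneg u)

theorem empNorm_nonneg : 0 ≤ empNorm u := Real.sqrt_nonneg _

theorem two_mul_empInner_le : 2 * empInner u v ≤ empInner u u + empInner v v := by
  have h := empInner_self_nonneg (u - v)
  rw [empInner_sub_left, empInner_sub_right, empInner_sub_right, empInner_comm v u] at h
  linarith

theorem empInner_sub_self_le :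
    empInner (u - v) (u - v) ≤ 2 * empInner u u + 2 * empInner v v := by
  have h := empInner_self_nonneg (u + v)
  rw [empInner_add_left, empInner_add_right, empInner_add_right, empInner_comm v u] at h
  rw [empInner_sub_left, empInner_sub_right, empInner_sub_right, empInner_comm v u]
  linarith

theorem eq_zero_of_empNorm_eq_zero {u : Fin n → ℝ} (h : empNorm u = 0) : u = 0 := by
  have h1 : empInner u u = 0 := by rw [← empNorm_sq, h]; ring
  ext i
  have hn : (0 : ℝ) < n := by exact_mod_cast i.pos
  rw [empInner, mul_eq_zero, or_iff_right (by positivity),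
    Finset.sum_eq_zero_iff_of_nonneg fun _ _ => mul_self_nonneg _] at h1
  exact mul_self_eq_zero.1 (h1 i (Finset.mem_univ _))

end EmpInner

/-! ### Greedy runs and their convergence rate -/

section Runs

variable {X : Type*} {n : ℕ} (z : Fin n → X × ℝ)

theorem empNorm_smul_empNormalized (g : X → ℝ) :
    empNorm (onDesign z g) • empNormalized z g = onDesign z g := by
  by_cases h : empNorm (onDesign z g) = 0
  · rw [h, zero_smul, eq_zero_of_empNorm_eq_zero h]
  · rw [empNormalized, smul_inv_smul₀ h]

theorem empInner_empNormalized_self_le (g : X → ℝ) :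
    empInner (empNormalized z g) (empNormalized z g) ≤ 1 := by
  rw [empNormalized, empInner_smul_left, empInner_smul_right, ← empNorm_sq]
  by_cases h : empNorm (onDesign z g) = 0
  · simp [h]
  · field_simp
    exact le_rfl

variable {z} {D : Finset (X → ℝ)} {f g : ℕ → X → ℝ}

theorem IsEmpProjection.empNorm_le {V : Submodule ℝ (X → ℝ)} {p v : X → ℝ}
    (h : IsEmpProjection z V p) (hv : v ∈ V) :
    empNorm (residual z p) ≤ empNorm (residual z v) := by
  refine Real.sqrt_le_sqrt ?_
  have h1 : residual z v = residual z p + onDesign z (p - v) := by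
    ext i
    simp [residual, onDesign]
  have h2 := h.2 _ (V.sub_mem h.1 hv)
  rw [h1, empInner_add_left, empInner_add_right, empInner_add_right,
    empInner_comm (onDesign z (p - v)), h2]
  linarith [empInner_self_nonneg (onDesign z (p - v))]

theorem selectedSpan_mono (g : ℕ → X → ℝ) : Monotone (selectedSpan g) := fun _ _ h =>
  Submodule.span_mono (Set.image_mono (Set.Icc_subset_Icc_right h))

theorem mem_selectedSpan (g : ℕ → X → ℝ) (k : ℕ) : g (k + 1) ∈ selectedSpan g (k + 1) :=
  Submodule.subset_span ⟨k + 1, ⟨by omega, le_rfl⟩, rfl⟩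

theorem IsGreedyRun.selected_mem {alg : GreedyAlgorithm} (h : IsGreedyRun alg D z f g) (k : ℕ) :
    g (k + 1) ∈ D := by
  cases alg
  · exact (h.2 k).1
  · exact (h.2 k).1
  · exact (h.2 k).1

theorem IsGreedyRun.zero {alg : GreedyAlgorithm} (h : IsGreedyRun alg D z f g) : f 0 = 0 := by
  cases alg
  · exact h.1
  · exact h.1
  · exact h.1

theorem IsGreedyRun.mem_selectedSpan {alg : GreedyAlgorithm} (h : IsGreedyRun alg D z f g)
    (k : ℕ) : f k ∈ selectedSpan g k := by
  induction k with
  | zero =>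
    rw [h.zero]
    exact Submodule.zero_mem _
  | succ k ih =>
    cases alg
    · exact (h.2 k).2.2.1
    · obtain ⟨-, β, hβ, -⟩ := h.2 k
      rw [hβ]
      exact Submodule.add_mem _ (Submodule.smul_mem _ _ (selectedSpan_mono g k.le_succ ih))
        (Submodule.smul_mem _ _ (GreedyLearning.mem_selectedSpan g k))
    · exact (h.2 k).2.1.1

/-- Each step of the three algorithms does at least as well as a relaxed step along an element
of maximal correlation with the residual. -/
theorem IsGreedyRun.step {alg : GreedyAlgorithm} (h : IsGreedyRun alg D z f g) (k : ℕ) :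
    ∃ g₀ ∈ D, (∀ g' ∈ D, |empInner (residual z (f k)) (empNormalized z g')| ≤
      |empInner (residual z (f k)) (empNormalized z g₀)|) ∧
      ∀ β : ℝ, empNorm (residual z (f (k + 1))) ≤
        empNorm (residual z (relaxation (k + 1) • f k + β • g₀)) := by
  have hmem := h.mem_selectedSpan k
  obtain ⟨g₀, hg₀, hmax⟩ := D.exists_max_image
    (fun g' => |empInner (residual z (f k)) (empNormalized z g')|) ⟨_, h.selected_mem k⟩
  cases alg
  · obtain ⟨h1, h2, h3⟩ := h.2 k
    refine ⟨_, h1, h2, fun β => h3.empNorm_le ?_⟩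
    exact Submodule.add_mem _ (Submodule.smul_mem _ _ (selectedSpan_mono g k.le_succ hmem))
      (Submodule.smul_mem _ _ (GreedyLearning.mem_selectedSpan g k))
  · obtain ⟨-, β', -, h2⟩ := h.2 k
    exact ⟨g₀, hg₀, hmax, fun β => h2 β g₀ hg₀⟩
  · obtain ⟨-, -, h3⟩ := h.2 k
    refine ⟨g₀, hg₀, hmax, fun β => h3 g₀ hg₀ _ ?_⟩
    exact Submodule.add_mem_sup (Submodule.smul_mem _ _ hmem)
      (Submodule.smul_mem _ _ (Submodule.mem_span_singleton_self g₀))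

theorem relaxation_mem_Icc (k : ℕ) : relaxation k ∈ Set.Icc (0 : ℝ) 1 := by
  unfold relaxation
  split_ifs with h
  · simp
  · have hk : (2 : ℝ) ≤ k := by exact_mod_cast (by omega : 2 ≤ k)
    have h1 : 2 / (k : ℝ) ≤ 1 := (div_le_one (by linarith)).2 hk
    have h2 : 0 ≤ 2 / (k : ℝ) := by positivity
    constructor <;> linarith

/-- One step of the greedy algorithms, compared with a combination `∑ c_i φ_i` of dictionary
elements. -/
theorem IsGreedyRun.empInner_residual_succ_le {alg : GreedyAlgorithm}
    (h : IsGreedyRun alg D z f g)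
    {N : ℕ} (c : Fin N → ℝ) (φ : Fin N → X → ℝ) (hφ : ∀ i, φ i ∈ D) {Q : ℝ}
    (hQ : 2 * empInner (residual z 0) (residual z 0) +
      2 * (∑ i, |c i| * empNorm (onDesign z (φ i))) ^ 2 ≤ Q) (k : ℕ) :
    empNorm (residual z (f (k + 1))) ^ 2 - empNorm (residual z (∑ i, c i • φ i)) ^ 2 ≤
      relaxation (k + 1) * (empNorm (residual z (f k)) ^ 2 -
        empNorm (residual z (∑ i, c i • φ i)) ^ 2) + (1 - relaxation (k + 1)) ^ 2 * Q := by
  obtain ⟨g₀, -, hmax, hstep⟩ := h.step k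
  obtain ⟨hα0, hα1⟩ := relaxation_mem_Icc (k + 1)
  set α := relaxation (k + 1)
  set M := ∑ i, |c i| * empNorm (onDesign z (φ i))
  set r := residual z (f k)
  set e := residual z (∑ i, c i • φ i)
  set y := residual z 0
  have hM : 0 ≤ M := Finset.sum_nonneg fun i _ => mul_nonneg (abs_nonneg _) (empNorm_nonneg _)
  obtain ⟨σ, hσ, hσ1⟩ : ∃ σ : ℝ, σ * empInner r (empNormalized z g₀) =
      |empInner r (empNormalized z g₀)| ∧ σ ^ 2 = 1 := by
    rcases le_total 0 (empInner r (empNormalized z g₀)) with h' | h'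
    · exact ⟨1, by rw [abs_of_nonneg h', one_mul], by norm_num⟩
    · exact ⟨-1, by rw [abs_of_nonpos h']; ring, by norm_num⟩
  -- The competitor moves along the most correlated element, with the sign of the correlation and
  -- the full weight `M` of the target combination.
  set G : Fin n → ℝ := (σ * M) • empNormalized z g₀ with hG
  have hres : residual z (α • f k + ((1 - α) * (σ * M) * (empNorm (onDesign z g₀))⁻¹) • g₀) =
      α • r + (1 - α) • (y - G) := by
    ext i
    simp only [residual, Pi.add_apply, Pi.smul_apply, smul_eq_mul, Pi.sub_apply, r, y, hG,
      empNormalized, onDesign, Pi.zero_apply]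
    ring
  have h1 : empNorm (residual z (f (k + 1))) ^ 2 ≤
      empInner (α • r + (1 - α) • (y - G)) (α • r + (1 - α) • (y - G)) := by
    rw [← empNorm_sq, ← hres]
    exact pow_le_pow_left₀ (empNorm_nonneg _) (hstep _) 2
  have hye : e = y - ∑ i, c i • onDesign z (φ i) := by
    ext i
    simp [e, y, residual, onDesign]
  -- The target has total weight `M`, so its correlation with the residual is at most `M` times the
  -- maximal one.
  have hrh : empInner r (∑ i, c i • onDesign z (φ i)) ≤ empInner r G := by
    rw [hG, empInner_smul_right, mul_right_comm, hσ, mul_comm, empInner_sum_right, Finset.sum_mul]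
    refine Finset.sum_le_sum fun i _ => ?_
    rw [empInner_smul_right, ← empNorm_smul_empNormalized z (φ i), empInner_smul_right,
      empNorm_smul_empNormalized, ← mul_assoc]
    refine (le_abs_self _).trans ?_
    rw [abs_mul, abs_mul, abs_of_nonneg (empNorm_nonneg _)]
    exact mul_le_mul_of_nonneg_left (hmax _ (hφ i))
      (mul_nonneg (abs_nonneg _) (empNorm_nonneg _))
  have hry : empInner r (y - G) ≤ empInner r e := by
    rw [hye, empInner_sub_right, empInner_sub_right]
    linarith
  have hre := two_mul_empInner_le r e
  have hyG : empInner (y - G) (y - G) ≤ Q := by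
    refine (empInner_sub_self_le y G).trans (le_trans ?_ hQ)
    rw [hG, empInner_smul_left, empInner_smul_right]
    have h2 : σ * M * (σ * M * empInner (empNormalized z g₀) (empNormalized z g₀)) =
        σ ^ 2 * (M ^ 2 * empInner (empNormalized z g₀) (empNormalized z g₀)) := by ring
    rw [h2, hσ1, one_mul]
    have h3 := mul_le_of_le_one_right (sq_nonneg M) (empInner_empNormalized_self_le z g₀)
    linarith
  have hexp : empInner (α • r + (1 - α) • (y - G)) (α • r + (1 - α) • (y - G)) =
      α ^ 2 * empInner r r + α * (1 - α) * (2 * empInner r (y - G)) +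
        (1 - α) ^ 2 * empInner (y - G) (y - G) := by
    rw [empInner_add_left, empInner_add_right, empInner_add_right, empInner_smul_left,
      empInner_smul_left, empInner_smul_left, empInner_smul_left, empInner_smul_right,
      empInner_smul_right, empInner_smul_right, empInner_smul_right, empInner_comm (y - G) r]
    ring
  rw [hexp] at h1
  rw [empNorm_sq e, empNorm_sq r]
  have h4 := mul_le_mul_of_nonneg_left (by linarith : 2 * empInner r (y - G) ≤
    empInner r r + empInner e e) (mul_nonneg hα0 (sub_nonneg.2 hα1))
  have h5 := mul_le_mul_of_nonneg_left hyG (sq_nonneg (1 - α))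
  have h6 := mul_nonneg (sq_nonneg (1 - α)) (empInner_self_nonneg e)
  nlinarith

/-- The relaxation is 0 at the first step, so the initial value is irrelevant; afterwards `1 - 2 /
(k + 1)` contracts fast enough to reproduce `4 * Q / k`. -/
theorem le_of_relaxed_recursion {x : ℕ → ℝ} {Q : ℝ} (hQ : 0 ≤ Q)
    (h : ∀ k, x (k + 1) ≤ relaxation (k + 1) * x k + (1 - relaxation (k + 1)) ^ 2 * Q)
    {k : ℕ} (hk : 0 < k) : x k ≤ 4 * Q / k := by
  induction k, hk using Nat.le_induction with
  | base =>
    have h0 := h 0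
    simp only [relaxation, zero_add, le_refl, if_true] at h0
    simp only [Nat.succ_eq_add_one, zero_add, Nat.cast_one, div_one]
    linarith
  | succ k hk ih =>
    have hk1 : 1 ≤ k := hk
    have hk0 : (1 : ℝ) ≤ k := by exact_mod_cast hk1
    have h0 := h k
    have hα := (relaxation_mem_Icc (k + 1)).1
    have hval : relaxation (k + 1) = 1 - 2 / ((k + 1 : ℕ) : ℝ) := by
      rw [relaxation, if_neg (by omega)]
    have h1 := mul_le_mul_of_nonneg_left ih hα
    refine h0.trans ((add_le_add_left h1 _).trans ?_)
    rw [hval]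
    push_cast
    have h2 : (1 - 2 / ((k : ℝ) + 1)) * (4 * Q / k) + (1 - (1 - 2 / ((k : ℝ) + 1))) ^ 2 * Q =
        4 * Q / (k + 1) - 4 * Q / (k * (k + 1) ^ 2) := by
      field_simp
      ring
    rw [h2]
    have : 0 ≤ 4 * Q / (k * ((k : ℝ) + 1) ^ 2) := by positivity
    linarith

/-- Convergence rate of the greedy algorithms. -/
theorem IsGreedyRun.empNorm_residual_sq_le {alg : GreedyAlgorithm}
    (h : IsGreedyRun alg D z f g)
    {N : ℕ} (c : Fin N → ℝ) (φ : Fin N → X → ℝ) (hφ : ∀ i, φ i ∈ D) {Q : ℝ}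
    (hQ : 2 * empInner (residual z 0) (residual z 0) +
      2 * (∑ i, |c i| * empNorm (onDesign z (φ i))) ^ 2 ≤ Q) {k : ℕ} (hk : 0 < k) :
    empNorm (residual z (f k)) ^ 2 ≤
      empNorm (residual z (∑ i, c i • φ i)) ^ 2 + 4 * Q / k := by
  have hQ0 : 0 ≤ Q := le_trans (add_nonneg (mul_nonneg two_pos.le (empInner_self_nonneg _))
    (mul_nonneg two_pos.le (sq_nonneg _))) hQ
  have := le_of_relaxed_recursion (x := fun k => empNorm (residual z (f k)) ^ 2 -
    empNorm (residual z (∑ i, c i • φ i)) ^ 2) hQ0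
    (fun k => h.empInner_residual_succ_le c φ hφ hQ k) hk
  linarith

end Runs

/-! ### The regression function -/

theorem eLpNorm_two_sq_eq {Ω : Type*} [MeasurableSpace Ω] {μ : Measure Ω} {u : Ω → ℝ}
    (hu : MemLp u 2 μ) : eLpNorm u 2 μ ^ 2 = ENNReal.ofReal (∫ ω, u ω ^ 2 ∂μ) := by
  have h := eLpNorm_nnreal_pow_eq_lintegral (f := u) (μ := μ) (p := 2) two_ne_zero
  rw [ofReal_integral_eq_lintegral_ofReal hu.integrable_sq (ae_of_all _ fun _ => sq_nonneg _)]
  simp only [NNReal.coe_ofNat, ENNReal.rpow_ofNat, ENNReal.coe_ofNat] at h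
  rw [h]
  refine lintegral_congr fun ω => ?_
  rw [Real.enorm_eq_ofReal_abs, ← ENNReal.ofReal_pow (abs_nonneg _), sq_abs]

theorem integral_fst_eq {X : Type*} [MeasurableSpace X] {ν : Measure (X × ℝ)} {u : X → ℝ} (hu : Measurable u) :
    ∫ x, u x ∂ν.fst = ∫ z, u z.1 ∂ν :=
  integral_map measurable_fst.aemeasurable hu.aestronglyMeasurable

theorem integrable_comp_fst {X : Type*} [MeasurableSpace X] {ν : Measure (X × ℝ)} {u : X → ℝ}
    (hu : Integrable u ν.fst) :
    Integrable (fun z => u z.1) ν :=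
  hu.comp_measurable measurable_fst

section Regression

variable {X : Type*} [MeasurableSpace X] (ρ : Measure (X × ℝ)) [IsProbabilityMeasure ρ]

theorem measurable_regressionFunction : Measurable (regressionFunction ρ) :=
  (StronglyMeasurable.integral_kernel (κ := ρ.condKernel) (f := fun y : ℝ => y)
    measurable_id.stronglyMeasurable).measurable

variable {ρ} {B : ℝ}

theorem ae_ae_condKernel (hy : ∀ᵐ z ∂ρ, |z.2| ≤ B) :
    ∀ᵐ x ∂ρ.fst, ∀ᵐ y ∂ρ.condKernel x, |y| ≤ B := by
  rw [← ρ.disintegrate ρ.condKernel] at hy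
  exact Measure.ae_ae_of_ae_compProd hy

theorem ae_abs_regressionFunction_le (hy : ∀ᵐ z ∂ρ, |z.2| ≤ B) :
    ∀ᵐ x ∂ρ.fst, |regressionFunction ρ x| ≤ B := by
  filter_upwards [ae_ae_condKernel hy] with x hx
  simpa [regressionFunction] using
    norm_integral_le_of_norm_le_const (μ := ρ.condKernel x) (f := fun y : ℝ => y) hx

/-- A version of the regression function bounded by `B`. -/
noncomputable def boundedRegression (B : ℝ) (ρ : Measure (X × ℝ)) [IsProbabilityMeasure ρ]
    (x : X) : ℝ := truncation B (regressionFunction ρ x)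

theorem boundedRegression_ae_eq (hy : ∀ᵐ z ∂ρ, |z.2| ≤ B) :
    boundedRegression B ρ =ᵐ[ρ.fst] regressionFunction ρ := by
  filter_upwards [ae_abs_regressionFunction_le hy] with x hx
  exact truncation_of_abs_le hx

theorem measurable_boundedRegression (hB : 0 ≤ B) : Measurable (boundedRegression B ρ) :=
  (continuous_truncation hB).measurable.comp (measurable_regressionFunction ρ)

theorem memLp_boundedRegression (hB : 0 ≤ B) : MemLp (boundedRegression B ρ) 2 ρ.fst :=
  MemLp.of_bound (measurable_boundedRegression hB).aestronglyMeasurable B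
    (ae_of_all _ fun _ => abs_truncation_le hB _)

theorem integrable_mul_comp_fst (hB : 0 ≤ B) {u : X → ℝ} (hu : Integrable u ρ.fst) :
    Integrable (fun z : X × ℝ => (truncation B z.2 - boundedRegression B ρ z.1) * u z.1) ρ := by
  refine (integrable_comp_fst hu).bdd_mul (c := 2 * B)
    ((((continuous_truncation hB).measurable.comp measurable_snd).sub
      ((measurable_boundedRegression hB).comp measurable_fst)).aestronglyMeasurable)
    (ae_of_all _ fun z => ?_)
  have h1 := abs_le.1 (abs_truncation_le hB z.2)
  have h2 := abs_le.1 (abs_truncation_le hB (regressionFunction ρ z.1))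
  rw [Real.norm_eq_abs, abs_le]
  unfold boundedRegression
  constructor <;> linarith [h1.1, h1.2, h2.1, h2.2]

theorem integral_sub_boundedRegression_mul (hB : 0 ≤ B) (hy : ∀ᵐ z ∂ρ, |z.2| ≤ B) {u : X → ℝ}
    (hu : Integrable u ρ.fst) :
    ∫ z : X × ℝ, (truncation B z.2 - boundedRegression B ρ z.1) * u z.1 ∂ρ = 0 := by
  rw [← Measure.integral_condKernel (integrable_mul_comp_fst hB hu)]
  refine integral_eq_zero_of_ae ?_
  filter_upwards [ae_ae_condKernel hy, boundedRegression_ae_eq hy] with x hx hx'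
  simp only [Pi.zero_apply]
  have h1 : ∫ y, truncation B y ∂ρ.condKernel x = boundedRegression B ρ x := by
    rw [hx', regressionFunction]
    refine integral_congr_ae ?_
    filter_upwards [hx] with y hy'
    exact truncation_of_abs_le hy'
  have h2 : Integrable (truncation B) (ρ.condKernel x) :=
    Integrable.of_bound (continuous_truncation hB).measurable.aestronglyMeasurable B
      (ae_of_all _ fun _ => abs_truncation_le hB _)
  rw [integral_mul_const, integral_sub h2 (integrable_const _), h1]
  simp

/-- Truncating both the data and the regression function makes the bounds hold everywhere, at the
price of null sets only. Orthogonality is the defining property of the conditional mean. -/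
theorem isRegression_boundedRegression (hB : 0 ≤ B) (hy : ∀ᵐ z ∂ρ, |z.2| ≤ B)
    {D : Finset (X → ℝ)} (hD : ∀ g ∈ D, Measurable g) :
    IsRegression ρ B (fun z => truncation B z.2) (fun z => boundedRegression B ρ z.1)
      (fun (d : D) z => d.1 z.1) where
  nonneg := hB
  measurable_Y := (continuous_truncation hB).measurable.comp measurable_snd
  measurable_f₀ := (measurable_boundedRegression hB).comp measurable_fst
  measurable_g d := (hD d.1 d.2).comp measurable_fst
  abs_Y_le _ := abs_truncation_le hB _
  abs_f₀_le _ := abs_truncation_le hB _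
  orthogonal k s c := by
    have hm : Measurable fun x => truncation B (∑ l, c l * (s l).1 x) :=
      (continuous_truncation hB).measurable.comp
        (Finset.measurable_sum _ fun l _ => (hD _ (s l).2).const_mul _)
    have hu : Integrable (fun x => truncation B (∑ l, c l * (s l).1 x) - boundedRegression B ρ x)
        ρ.fst := (Integrable.of_bound hm.aestronglyMeasurable B
          (ae_of_all _ fun _ => abs_truncation_le hB _)).sub
            ((memLp_boundedRegression hB).integrable one_le_two)
    exact integral_sub_boundedRegression_mul hB hy hu

theorem squaredError_eq (hB : 0 ≤ B) (hy : ∀ᵐ z ∂ρ, |z.2| ≤ B) {u : X → ℝ} (hu : Measurable u)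
    (huB : ∀ x, |u x| ≤ B) : squaredError ρ u =
      ENNReal.ofReal (sqDist ρ (fun z => boundedRegression B ρ z.1) fun z => u z.1) := by
  have hmem : MemLp (fun x => u x - boundedRegression B ρ x) 2 ρ.fst :=
    (MemLp.of_bound hu.aestronglyMeasurable B (ae_of_all _ huB)).sub (memLp_boundedRegression hB)
  have hae : (fun x => u x - regressionFunction ρ x) =ᵐ[ρ.fst]
      fun x => u x - boundedRegression B ρ x := by
    filter_upwards [boundedRegression_ae_eq hy] with x hx
    rw [hx]
  rw [squaredError, eLpNorm_congr_ae hae, eLpNorm_two_sq_eq hmem,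
    integral_fst_eq (u := fun x => (u x - boundedRegression B ρ x) ^ 2)
      ((hu.sub (measurable_boundedRegression hB)).pow_const 2)]
  rfl

/-- The excess risk of a square integrable function of `x` is its squared distance to the
regression function. -/
theorem integral_excessLoss (hB : 0 ≤ B) (hy : ∀ᵐ z ∂ρ, |z.2| ≤ B) {h : X → ℝ}
    (hh : MemLp h 2 ρ.fst) (hm : Measurable h) :
    Integrable (excessLoss (fun z => truncation B z.2) (fun z => boundedRegression B ρ z.1)
      fun z => h z.1) ρ ∧
    ∫ z, excessLoss (fun z => truncation B z.2) (fun z => boundedRegression B ρ z.1)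
      (fun z => h z.1) z ∂ρ = ∫ x, (h x - boundedRegression B ρ x) ^ 2 ∂ρ.fst := by
  have hu : MemLp (fun x => h x - boundedRegression B ρ x) 2 ρ.fst :=
    hh.sub (memLp_boundedRegression hB)
  have h1 := integrable_comp_fst hu.integrable_sq
  have h2 := integrable_mul_comp_fst hB (hu.integrable one_le_two)
  have heq : ∀ z : X × ℝ, excessLoss (fun z => truncation B z.2)
      (fun z => boundedRegression B ρ z.1) (fun z => h z.1) z =
      (h z.1 - boundedRegression B ρ z.1) ^ 2 -
        2 * ((truncation B z.2 - boundedRegression B ρ z.1) *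
          (h z.1 - boundedRegression B ρ z.1)) := fun z => by
    unfold excessLoss
    ring
  refine ⟨(h1.sub (h2.const_mul 2)).congr (ae_of_all _ fun z => (heq z).symm), ?_⟩
  simp only [heq]
  rw [integral_sub h1 (h2.const_mul 2), integral_const_mul,
    integral_sub_boundedRegression_mul hB hy (hu.integrable one_le_two), mul_zero, sub_zero,
    integral_fst_eq (u := fun x => (h x - boundedRegression B ρ x) ^ 2)
      ((hm.sub (measurable_boundedRegression hB)).pow_const 2)]

theorem exists_mem_span_ae_eq {μ : Measure X} {dict : Set (X → ℝ)} {F : Lp ℝ 2 μ}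
    (hF : F ∈ Submodule.span ℝ {F : Lp ℝ 2 μ | ∃ g ∈ dict, F =ᵐ[μ] g}) :
    ∃ h ∈ Submodule.span ℝ dict, F =ᵐ[μ] h := by
  induction hF using Submodule.span_induction with
  | mem F hF =>
    obtain ⟨g, hg, hFg⟩ := hF
    exact ⟨g, Submodule.subset_span hg, hFg⟩
  | zero => exact ⟨0, Submodule.zero_mem _, Lp.coeFn_zero _ _ _⟩
  | add F G _ _ hF hG =>
    obtain ⟨h, hh, hFh⟩ := hF
    obtain ⟨k, hk, hGk⟩ := hG
    exact ⟨h + k, Submodule.add_mem _ hh hk, (Lp.coeFn_add F G).trans (hFh.add hGk)⟩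
  | smul r F _ hF =>
    obtain ⟨h, hh, hFh⟩ := hF
    exact ⟨r • h, Submodule.smul_mem _ _ hh, (Lp.coeFn_smul r F).trans (hFh.const_smul r)⟩

/-- A complete dictionary approximates every square integrable function. -/
theorem IsCompleteDictionary.exists_approx {μ : Measure X} {dict : Set (X → ℝ)}
    (hc : IsCompleteDictionary μ dict) (hd : ∀ g ∈ dict, MemLp g 2 μ) {f : X → ℝ}
    (hf : MemLp f 2 μ) {ε : ℝ} (hε : 0 < ε) :
    ∃ (N : ℕ) (c : Fin N → ℝ) (φ : Fin N → X → ℝ), (∀ i, φ i ∈ dict) ∧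
      ∫ x, ((∑ i, c i • φ i) x - f x) ^ 2 ∂μ < ε := by
  obtain ⟨F, hF, hdist⟩ := EMetric.mem_closure_iff.1 (hc (hf.toLp f))
    (ENNReal.ofReal (Real.sqrt ε)) (by simpa using hε)
  obtain ⟨h, hh, hFh⟩ := exists_mem_span_ae_eq hF
  obtain ⟨N, c, φ, rfl⟩ := Submodule.mem_span_set'.1 hh
  refine ⟨N, c, fun i => φ i, fun i => (φ i).2, ?_⟩
  have hmem : MemLp (fun x => (∑ i, c i • (φ i : X → ℝ)) x - f x) 2 μ :=
    (memLp_finsetSum' _ fun i _ => (hd _ (φ i).2).const_smul (c i)).sub hf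
  rw [edist_comm, Lp.edist_def] at hdist
  have hae : (F - hf.toLp f : X → ℝ) =ᵐ[μ] fun x => (∑ i, c i • (φ i : X → ℝ)) x - f x := by
    filter_upwards [hFh, hf.coeFn_toLp] with x h1 h2
    rw [Pi.sub_apply, h1, h2]
  rw [eLpNorm_congr_ae hae] at hdist
  have h1 := ENNReal.pow_right_strictMono two_ne_zero hdist
  simp only at h1
  rw [eLpNorm_two_sq_eq hmem, ← ENNReal.ofReal_pow (Real.sqrt_nonneg _), Real.sq_sqrt hε.le] at h1
  exact (ENNReal.ofReal_lt_ofReal_iff hε).1 h1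

end Regression

/-! ### The oracle inequality -/

section Oracle

variable {X : Type*}

/-- Twice the excess loss of `∑ c_i φ_i`, plus a bound for the error of `j` greedy steps. -/
noncomputable def oracleLoss (B : ℝ) (f₀ : X × ℝ → ℝ) {N : ℕ} (c : Fin N → ℝ)
    (φ : Fin N → X → ℝ) (j : ℕ) (z : X × ℝ) : ℝ :=
  2 * excessLoss (fun z => truncation B z.2) f₀ (fun z => (∑ i, c i • φ i) z.1) z +
    8 / j * (2 * truncation B z.2 ^ 2 + 2 * (N * ∑ i, c i ^ 2 * φ i z.1 ^ 2))

theorem IsGreedyRun.exists_coeff {n : ℕ} {z : Fin n → X × ℝ} {D : Finset (X → ℝ)}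
    {f g : ℕ → X → ℝ} {alg : GreedyAlgorithm} (h : IsGreedyRun alg D z f g) (k : ℕ) :
    ∃ (s : Fin k → D) (c : Fin k → ℝ), ∀ x, f k x = ∑ l, c l * (s l).1 x := by
  have hmem := h.mem_selectedSpan k
  have himage : g '' Set.Icc 1 k = Set.range fun l : Fin k => g (l + 1) := by
    ext u
    constructor
    · rintro ⟨i, ⟨hi1, hik⟩, rfl⟩
      exact ⟨⟨i - 1, by omega⟩, by simp only; congr 1; omega⟩
    · rintro ⟨l, rfl⟩
      exact ⟨l + 1, ⟨by omega, l.isLt⟩, rfl⟩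
  rw [selectedSpan, himage, Submodule.mem_span_range_iff_exists_fun] at hmem
  obtain ⟨c, hc⟩ := hmem
  refine ⟨fun l => ⟨g (l + 1), h.selected_mem l⟩, c, fun x => ?_⟩
  rw [← hc]
  simp

theorem empNorm_residual_sq {n : ℕ} (z : Fin n → X × ℝ) (u : X → ℝ) :
    empNorm (residual z u) ^ 2 = 1 / (n : ℝ) * ∑ i, ((z i).2 - u (z i).1) ^ 2 := by
  rw [empNorm_sq, empInner]
  simp only [residual, pow_two]

theorem IsGreedyEstimator.abs_le {n : ℕ} {z : Fin n → X × ℝ} {D : Finset (X → ℝ)}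
    {alg : GreedyAlgorithm} {B κ : ℝ} {fhat : X → ℝ} (hB : 0 ≤ B)
    (hf : IsGreedyEstimator alg B κ D z fhat) (x : X) : |fhat x| ≤ B := by
  obtain ⟨f, g, -, k, -, -, rfl⟩ := hf
  exact abs_truncation_le hB _

variable [MeasurableSpace X] {ρ : Measure (X × ℝ)} [IsProbabilityMeasure ρ]

/-- The deviation bound holds for all `k` at once, so it applies at the data-dependent index; the
hypothesis on `κ` lets the penalty absorb its complexity term. -/
theorem sqDist_estimator_le {B κ lam A : ℝ} {f₀ : X × ℝ → ℝ} {D : Finset (X → ℝ)}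
    (H : IsRegression ρ B (fun z => truncation B z.2) f₀ (fun (d : D) z => d.1 z.1))
    (hlam : 0 < lam) (hκ : A / lam ≤ 2 * κ) {n : ℕ} (hn : 0 < n) {z : Fin n → X × ℝ}
    (hz : ∀ i, |(z i).2| ≤ B)
    (hfin : expDeviation ρ B lam A (fun z => truncation B z.2) f₀
      (fun (d : D) z => d.1 z.1) z ≠ ∞) {alg : GreedyAlgorithm} {fhat : X → ℝ}
    (hf : IsGreedyEstimator alg B κ D z fhat) {N : ℕ} (c : Fin N → ℝ) (φ : Fin N → X → ℝ)
    (hφ : ∀ i, φ i ∈ D) {j : ℕ} (hj : 0 < j) :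
    sqDist ρ f₀ (fun z => fhat z.1) ≤
      (expDeviation ρ B lam A (fun z => truncation B z.2) f₀
        (fun (d : D) z => d.1 z.1) z).toReal / (lam * n) +
      1 / (n : ℝ) * ∑ i, oracleLoss B f₀ c φ j (z i) + 2 * κ * (j * Real.log n / n) := by
  obtain ⟨f, g, hrun, k, hk, hmin, rfl⟩ := hf
  obtain ⟨s, c', hc'⟩ := hrun.exists_coeff k
  have hn' : (0 : ℝ) < n := by exact_mod_cast hn
  have hn1 : (1 : ℝ) ≤ n := by exact_mod_cast hn
  have hj' : (0 : ℝ) < j := by exact_mod_cast hj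
  set E := expDeviation ρ B lam A (fun z => truncation B z.2) f₀ (fun (d : D) z => d.1 z.1) z
  have hcomb : truncComb B (fun (d : D) (z : X × ℝ) => d.1 z.1) s c' =
      fun z => truncation B (f k z.1) := by
    ext z
    rw [truncComb, hc']
  have hdev := H.ofReal_exp_le_expDeviation lam A hk s c' z
  rw [ENNReal.ofReal_le_iff_le_toReal hfin, hcomb] at hdev
  set R := sqDist ρ f₀ fun z => truncation B (f k z.1)
  have hY : ∀ i, truncation B (z i).2 = (z i).2 := fun i => truncation_of_abs_le (hz i)
  set S₀ := 1 / (n : ℝ) * ∑ i, ((z i).2 - f₀ (z i)) ^ 2 with hS₀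
  have hsum : ∀ u : X → ℝ, ∑ i, excessLoss (fun z => truncation B z.2) f₀ (fun z => u z.1) (z i) =
      n * (empNorm (residual z u) ^ 2 - S₀) := fun u => by
    simp only [excessLoss, hY, Finset.sum_sub_distrib, empNorm_residual_sq, hS₀]
    field_simp
  -- the bound on the risk of the estimator by its empirical risk
  have h1 : R ≤ E.toReal / (lam * n) + 2 * (empNorm (residual z fun x => truncation B (f k x)) ^ 2 -
      S₀) + A / lam * (k * Real.log n / n) := by
    -- Linearizing the exponential keeps the bound integrable, with mean of order `1 / n`.
    have h2 := (Real.add_one_le_exp _).trans hdev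
    rw [Finset.sum_sub_distrib, Finset.sum_const, Finset.card_univ, Fintype.card_fin,
      nsmul_eq_mul, ← Finset.mul_sum, hsum fun x => truncation B (f k x)] at h2
    set F := empNorm (residual z fun x => truncation B (f k x)) ^ 2
    have h3 : E.toReal / (lam * n) + 2 * (F - S₀) + A / lam * (k * Real.log n / n) =
        (E.toReal + lam * (2 * (n * (F - S₀))) + A * (k * Real.log n)) / (lam * n) := by
      field_simp
    rw [h3, le_div_iff₀ (by positivity)]
    linarith
  have hlogn : 0 ≤ Real.log n := Real.log_nonneg hn1
  have h4 : A / lam * (k * Real.log n / n) ≤ 2 * κ * (k * Real.log n / n) :=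
    mul_le_mul_of_nonneg_right hκ (by positivity)
  -- comparison with the penalized empirical risk after `j` steps
  have h5 := hmin j hj
  simp only [penalizedRisk] at h5
  have h6 : empNorm (residual z fun x => truncation B (f j x)) ^ 2 ≤
      empNorm (residual z (f j)) ^ 2 := by
    rw [empNorm_residual_sq, empNorm_residual_sq]
    exact mul_le_mul_of_nonneg_left
      (Finset.sum_le_sum fun i _ => sq_sub_truncation_le (hz i) _) (by positivity)
  set Q := 1 / (n : ℝ) * ∑ i, (2 * truncation B (z i).2 ^ 2 +
    2 * (N * ∑ l, c l ^ 2 * φ l (z i).1 ^ 2)) with hQ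
  -- Cauchy-Schwarz replaces the squared sum of empirical norms by a sample mean, whose expectation
  -- is explicit.
  have h7 := hrun.empNorm_residual_sq_le c φ hφ (Q := Q) (by
    have hcs := sq_sum_le_card_mul_sum_sq (s := Finset.univ)
      (f := fun l => |c l| * empNorm (onDesign z (φ l)))
    rw [Finset.card_univ, Fintype.card_fin] at hcs
    have hE : ∀ l, (|c l| * empNorm (onDesign z (φ l))) ^ 2 =
        1 / (n : ℝ) * ∑ i, c l ^ 2 * φ l (z i).1 ^ 2 := fun l => by
      rw [mul_pow, sq_abs, empNorm_sq, empInner, ← Finset.mul_sum]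
      simp only [onDesign, pow_two]
      ring
    have hQ' : Q = 2 * empInner (residual z 0) (residual z 0) +
        2 * (N * ∑ l, (|c l| * empNorm (onDesign z (φ l))) ^ 2) := by
      rw [← empNorm_sq, empNorm_residual_sq]
      simp only [hE, hQ, hY, Finset.sum_add_distrib, ← Finset.mul_sum, Pi.zero_apply, sub_zero]
      rw [Finset.sum_comm]
      simp only [← Finset.mul_sum]
      ring
    rw [hQ']
    linarith) hj
  have h8 : 1 / (n : ℝ) * ∑ i, oracleLoss B f₀ c φ j (z i) =
      2 * (empNorm (residual z (∑ i, c i • φ i)) ^ 2 - S₀) + 8 / j * Q := by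
    simp only [oracleLoss]
    rw [Finset.sum_add_distrib, ← Finset.mul_sum, ← Finset.mul_sum, hsum, hQ]
    field_simp
  rw [h8]
  have h9 : 8 / (j : ℝ) * Q = 2 * (4 * Q / j) := by ring
  rw [h9]
  linarith

theorem IsGreedyEstimator.measurable {n : ℕ} {z : Fin n → X × ℝ} {D : Finset (X → ℝ)}
    {alg : GreedyAlgorithm} {B κ : ℝ} {fhat : X → ℝ} (hB : 0 ≤ B) (hD : ∀ g ∈ D, Measurable g)
    (hf : IsGreedyEstimator alg B κ D z fhat) : Measurable fhat := by
  obtain ⟨f, g, hrun, k, -, -, rfl⟩ := hf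
  obtain ⟨s, c, hc⟩ := hrun.exists_coeff k
  simp only [hc]
  exact (continuous_truncation hB).measurable.comp
    (Finset.measurable_sum _ fun l _ => (hD _ (s l).2).const_mul _)

/-- The majorant is infinite off the good set, which costs nothing because that set has full
measure; no measurability of `F` is needed. -/
theorem upperExpectation_le_of_ae_le {Ω : Type*} [MeasurableSpace Ω] {μ : Measure Ω}
    {F : Ω → ℝ≥0∞} {G : Ω → ℝ} (hG : Measurable G) (hGi : Integrable G μ) {good : Set Ω}
    (hgood : MeasurableSet good) (hae : ∀ᵐ ω ∂μ, ω ∈ good) (hG0 : ∀ ω ∈ good, 0 ≤ G ω)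
    (h : ∀ ω ∈ good, F ω ≤ ENNReal.ofReal (G ω)) :
    upperExpectation μ F ≤ ENNReal.ofReal (∫ ω, G ω ∂μ) := by
  classical
  refine iInf_le_of_le (good.piecewise (fun ω => ENNReal.ofReal (G ω)) fun _ => ∞)
    (iInf_le_of_le ((ENNReal.measurable_ofReal.comp hG).piecewise hgood measurable_const)
      (iInf_le_of_le (fun ω => ?_) ?_))
  · by_cases hω : ω ∈ good
    · simpa [hω] using h ω hω
    · simp [hω]
  · rw [ofReal_integral_eq_lintegral_ofReal hGi (hae.mono hG0)]
    refine (lintegral_congr_ae (hae.mono fun ω hω => ?_)).le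
    simp [hω]

theorem upperExpectation_squaredError_le {B b a κ lam : ℝ} (hB : 0 ≤ B) (hBb : B ≤ b) (hb : 0 < b)
    (hlam : 0 < lam) (hlamb : 162 * b ^ 2 * lam ≤ 1) (hκ : (a + 11) / lam ≤ 2 * κ)
    (hy : ∀ᵐ z ∂ρ, |z.2| ≤ B) {D : Finset (X → ℝ)} {n : ℕ} (hn : 2 ≤ n)
    (hD : ∀ g ∈ D, Measurable g) (hcard : (D.card : ℝ) ≤ (n : ℝ) ^ a) {alg : GreedyAlgorithm}
    {fhat : (Fin n → X × ℝ) → X → ℝ} (hf : ∀ z, IsGreedyEstimator alg B κ D z (fhat z))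
    {N : ℕ} (c : Fin N → ℝ) (φ : Fin N → X → ℝ)
    (hφ : ∀ i, φ i ∈ D) (hφ2 : ∀ i, MemLp (φ i) 2 ρ.fst) {j : ℕ} (hj : 0 < j) :
    upperExpectation (Measure.pi fun _ : Fin n => ρ) (fun z => squaredError ρ (fhat z)) ≤
      ENNReal.ofReal (Real.exp 1 / (lam * n) +
        (2 * ∫ x, ((∑ i, c i • φ i) x - boundedRegression B ρ x) ^ 2 ∂ρ.fst +
          8 / j * (2 * B ^ 2 + 2 * (N * ∑ i, c i ^ 2 * ∫ x, φ i x ^ 2 ∂ρ.fst))) +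
        2 * κ * (j * Real.log n / n)) := by
  have H := isRegression_boundedRegression hB hy hD
  set f₀ : X × ℝ → ℝ := fun z => boundedRegression B ρ z.1
  set Y : X × ℝ → ℝ := fun z => truncation B z.2
  set gD : D → X × ℝ → ℝ := fun d z => d.1 z.1
  set E : (Fin n → X × ℝ) → ℝ≥0∞ := expDeviation ρ B lam (a + 11) Y f₀ gD with hE
  set μ := Measure.pi fun _ : Fin n => ρ
  have hn' : (0 : ℝ) < n := by exact_mod_cast (by omega : 0 < n)
  have hEm : Measurable E := H.measurable_expDeviation _ _ _
  have hEint : ∫⁻ z, E z ∂μ ≤ ENNReal.ofReal (Real.exp 1) :=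
    H.lintegral_expDeviation_le hBb hb hlam.le hlamb hn (by simpa using hcard)
  have hEtop : ∫⁻ z, E z ∂μ ≠ ∞ := (hEint.trans_lt ENNReal.ofReal_lt_top).ne
  have hEi : Integrable (fun z => (E z).toReal) μ :=
    integrable_toReal_of_lintegral_ne_top hEm.aemeasurable hEtop
  have hEval : ∫ z, (E z).toReal ∂μ ≤ Real.exp 1 := by
    rw [integral_toReal hEm.aemeasurable (ae_lt_top hEm hEtop)]
    exact ENNReal.toReal_le_of_le_ofReal (Real.exp_pos 1).le hEint
  -- the oracle loss
  have hhm : Measurable (∑ i, c i • φ i) :=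
    Finset.sum_induction _ Measurable (fun _ _ h h' => h.add h') measurable_const
      fun i _ => (hD _ (hφ i)).const_smul (c i)
  have hh2 : MemLp (∑ i, c i • φ i) 2 ρ.fst :=
    memLp_finsetSum' _ fun i _ => (hφ2 i).const_smul (c i)
  obtain ⟨hL1, hL2⟩ := integral_excessLoss hB hy hh2 hhm
  have hYm : Measurable Y := H.measurable_Y
  have hYi : Integrable (fun z => Y z ^ 2) ρ :=
    Integrable.of_bound (hYm.pow_const 2).aestronglyMeasurable (B ^ 2) (ae_of_all _ fun z => by
      rw [Real.norm_eq_abs, abs_pow]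
      exact pow_le_pow_left₀ (abs_nonneg _) (H.abs_Y_le z) 2)
  have hφi : ∀ i, Integrable (fun z : X × ℝ => c i ^ 2 * φ i z.1 ^ 2) ρ := fun i =>
    (integrable_comp_fst (hφ2 i).integrable_sq).const_mul _
  have hsi : Integrable (fun z : X × ℝ => 2 * (N * ∑ i, c i ^ 2 * φ i z.1 ^ 2)) ρ :=
    ((integrable_finsetSum _ fun i _ => hφi i).const_mul _).const_mul _
  have hqi : Integrable (fun z : X × ℝ => 2 * Y z ^ 2 + 2 * (N * ∑ i, c i ^ 2 * φ i z.1 ^ 2)) ρ :=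
    (hYi.const_mul 2).add hsi
  have hOi : Integrable (oracleLoss B f₀ c φ j) ρ := (hL1.const_mul 2).add (hqi.const_mul _)
  have hOm : Measurable (oracleLoss B f₀ c φ j) := by
    have h1 := H.measurable_f₀
    have h2 : ∀ i, Measurable (φ i) := fun i => hD _ (hφ i)
    have h3 : Measurable (truncation B) := (continuous_truncation hB).measurable
    unfold oracleLoss excessLoss
    fun_prop
  have hOval : ∫ z, oracleLoss B f₀ c φ j z ∂ρ ≤
      2 * ∫ x, ((∑ i, c i • φ i) x - boundedRegression B ρ x) ^ 2 ∂ρ.fst +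
          8 / j * (2 * B ^ 2 + 2 * (N * ∑ i, c i ^ 2 * ∫ x, φ i x ^ 2 ∂ρ.fst)) := by
    have h1 : ∫ z, Y z ^ 2 ∂ρ ≤ B ^ 2 := by
      have := integral_mono hYi (integrable_const (B ^ 2)) fun z => by
        have := pow_le_pow_left₀ (abs_nonneg _) (H.abs_Y_le z) 2
        rwa [sq_abs] at this
      simpa using this
    simp only [oracleLoss]
    rw [integral_add (hL1.const_mul 2) (hqi.const_mul _), integral_const_mul, integral_const_mul,
      hL2, integral_add (hYi.const_mul 2) hsi, integral_const_mul, integral_const_mul,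
      integral_const_mul, integral_finsetSum _ fun i _ => hφi i]
    have h2 : ∀ i, ∫ z : X × ℝ, c i ^ 2 * φ i z.1 ^ 2 ∂ρ = c i ^ 2 * ∫ x, φ i x ^ 2 ∂ρ.fst :=
      fun i => by
        rw [integral_const_mul, integral_fst_eq (u := fun x => φ i x ^ 2)
          ((hD _ (hφ i)).pow_const 2)]
    simp only [h2]
    gcongr
  -- the majorant
  set G : (Fin n → X × ℝ) → ℝ := fun z => (E z).toReal / (lam * n) +
    1 / (n : ℝ) * ∑ i, oracleLoss B f₀ c φ j (z i) + 2 * κ * (j * Real.log n / n)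
  have hGm : Measurable G := by
    have h1 : Measurable fun z : Fin n → X × ℝ => ∑ i, oracleLoss B f₀ c φ j (z i) :=
      Finset.measurable_sum _ fun i _ => hOm.comp (measurable_pi_apply i)
    exact ((hEm.ennreal_toReal.div_const _).add (h1.const_mul _)).add_const _
  have hOpi : ∀ i : Fin n, Integrable (fun z : Fin n → X × ℝ => oracleLoss B f₀ c φ j (z i)) μ :=
    fun i => integrable_comp_eval (μ := fun _ : Fin n => ρ) (i := i) hOi
  have hOs : Integrable (fun z : Fin n → X × ℝ =>
      1 / (n : ℝ) * ∑ i, oracleLoss B f₀ c φ j (z i)) μ :=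
    (integrable_finsetSum _ fun i _ => hOpi i).const_mul _
  have hEO : Integrable (fun z : Fin n → X × ℝ => (E z).toReal / (lam * n) +
      1 / (n : ℝ) * ∑ i, oracleLoss B f₀ c φ j (z i)) μ := (hEi.div_const _).add hOs
  have hGi : Integrable G μ := hEO.add (integrable_const _)
  have hGval : ∫ z, G z ∂μ = (∫ z, (E z).toReal ∂μ) / (lam * n) +
      ∫ z, oracleLoss B f₀ c φ j z ∂ρ + 2 * κ * (j * Real.log n / n) := by
    simp only [G]
    rw [integral_add hEO (integrable_const _), integral_add (hEi.div_const _) hOs,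
      integral_div, integral_const_mul, integral_finsetSum _ fun i _ => hOpi i]
    have h1 : ∀ i : Fin n, ∫ z : Fin n → X × ℝ, oracleLoss B f₀ c φ j (z i) ∂μ =
        ∫ z, oracleLoss B f₀ c φ j z ∂ρ := fun i =>
      integral_comp_eval (μ := fun _ : Fin n => ρ) (i := i) hOm.aestronglyMeasurable
    simp only [h1, Finset.sum_const, Finset.card_univ, Fintype.card_fin, nsmul_eq_mul,
      integral_const, probReal_univ, one_smul]
    field_simp
  have hbound : ∀ z ∈ {z : Fin n → X × ℝ | (∀ i, |(z i).2| ≤ B) ∧ E z ≠ ∞},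
      sqDist ρ f₀ (fun x => fhat z x.1) ≤ G z := fun z hz =>
    sqDist_estimator_le H hlam hκ (by omega) hz.1 hz.2 (hf z) c φ hφ hj
  refine (upperExpectation_le_of_ae_le hGm hGi
    (good := {z | (∀ i, |(z i).2| ≤ B) ∧ E z ≠ ∞}) ?_ ?_ (fun z hz => ?_) fun z hz => ?_).trans ?_
  · have h1 : {z : Fin n → X × ℝ | ∀ i, |(z i).2| ≤ B} = ⋂ i, {z | |(z i).2| ≤ B} := by
      ext
      simp
    refine MeasurableSet.inter (s₁ := {z | ∀ i, |(z i).2| ≤ B}) ?_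
      (hEm (measurableSet_singleton ∞).compl)
    rw [h1]
    exact MeasurableSet.iInter fun i => measurableSet_le
      (measurable_snd.comp (measurable_pi_apply i)).abs measurable_const
  · have h1 : ∀ᵐ z ∂μ, ∀ i, |(z i).2| ≤ B := ae_all_iff.2 fun i =>
      (measurePreserving_eval (fun _ : Fin n => ρ) i).quasiMeasurePreserving.ae hy
    filter_upwards [h1, ae_lt_top hEm hEtop] with z hz1 hz2
    exact ⟨hz1, hz2.ne⟩
  · exact le_trans (integral_nonneg fun _ => sq_nonneg _) (hbound z hz)
  · rw [squaredError_eq hB hy ((hf z).measurable hB hD) ((hf z).abs_le hB)]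
    exact ENNReal.ofReal_le_ofReal (hbound z hz)
  · rw [hGval]
    exact ENNReal.ofReal_le_ofReal (by gcongr)

end Oracle

end GreedyLearning

/-! ### Universal consistency -/

theorem theorem3p8 (B a : ℝ) (hB : 0 ≤ B) (ha : 0 < a) :
    ∃ κ₀ : ℝ, 0 < κ₀ ∧ ∀ κ : ℝ, κ₀ ≤ κ →
      ∀ (alg : GreedyLearning.GreedyAlgorithm)
        (X : Type*) [MeasurableSpace X]
        (ρ : Measure (X × ℝ)) [IsProbabilityMeasure ρ],
        (∀ᵐ z ∂ρ, |z.2| ≤ B) →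
      ∀ (dict : Set (X → ℝ)) (D : ℕ → Finset (X → ℝ)),
        GreedyLearning.IsExhaustion dict D →
        (∀ g ∈ dict, Measurable g ∧ MemLp g 2 ρ.fst) →
        GreedyLearning.IsCompleteDictionary ρ.fst dict →
      ∀ fhat : (n : ℕ) → (Fin n → X × ℝ) → X → ℝ,
        (∀ n : ℕ, 0 < n → ∀ z : Fin n → X × ℝ,
          GreedyLearning.IsGreedyEstimator alg B κ (D ⌊(n : ℝ) ^ a⌋₊) z (fhat n z)) →
        Tendsto
          (fun n : ℕ => GreedyLearning.upperExpectation (Measure.pi fun _ : Fin n => ρ)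
            (fun z => GreedyLearning.squaredError ρ (fhat n z)))
          atTop (𝓝 0) := by
  -- Using `B + 1` instead of `B` keeps `lam` meaningful when `B = 0`.
  have hb : 0 < B + 1 := by linarith
  have hlam : 0 < (162 * (B + 1) ^ 2)⁻¹ := by positivity
  set lam := (162 * (B + 1) ^ 2)⁻¹ with hlam_def
  refine ⟨(a + 11) / lam, by positivity, fun κ hκ alg X _ ρ _ hy dict D hD hdict hcomplete fhat
    hfhat => ?_⟩
  have hκ0 : 0 < (a + 11) / lam := by positivity
  have hmemdict : ∀ m, ∀ g ∈ D m, g ∈ dict := fun m g hg => by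
    rw [← hD.iUnion_eq]
    exact Set.mem_iUnion.2 ⟨m, hg⟩
  rw [ENNReal.tendsto_nhds_zero]
  intro ε hε
  obtain ⟨η, hη0, hηε⟩ : ∃ η : ℝ, 0 < η ∧ ENNReal.ofReal η ≤ ε := by
    obtain ⟨η, hη0, hηε⟩ := ENNReal.lt_iff_exists_nnreal_btwn.1 hε
    exact ⟨η, by exact_mod_cast hη0, by simpa using hηε.le⟩
  -- The error has four terms, each allotted `η / 4`; the approximation error enters doubled, hence
  -- `η / 8`.
  obtain ⟨N, c, φ, hφ, happ⟩ := hcomplete.exists_approx (fun g hg => (hdict g hg).2)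
    (GreedyLearning.memLp_boundedRegression (ρ := ρ) hB) (ε := η / 8) (by positivity)
  set q := 2 * B ^ 2 + 2 * (N * ∑ i, c i ^ 2 * ∫ x, φ i x ^ 2 ∂ρ.fst)
  obtain ⟨j, hj, hjq⟩ : ∃ j : ℕ, 0 < j ∧ 8 / (j : ℝ) * q ≤ η / 4 := by
    have h1 : Tendsto (fun j : ℕ => 8 / (j : ℝ) * q) atTop (𝓝 (0 * q)) :=
      (tendsto_const_div_atTop_nhds_zero_nat 8).mul_const q
    rw [zero_mul] at h1
    obtain ⟨j, h2, h3⟩ := ((h1.eventually (ge_mem_nhds (by positivity : 0 < η / 4))).and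
      (eventually_gt_atTop 0)).exists
    exact ⟨j, h3, h2⟩
  have hlim1 : ∀ᶠ n : ℕ in atTop, Real.exp 1 / (lam * n) ≤ η / 4 := by
    have h1 := tendsto_const_div_atTop_nhds_zero_nat (Real.exp 1 / lam)
    simp only [div_div] at h1
    exact h1.eventually (ge_mem_nhds (by positivity))
  have hlim2 : ∀ᶠ n : ℕ in atTop, 2 * κ * (j * Real.log n / n) ≤ η / 4 := by
    have h1 : Tendsto (fun n : ℕ => Real.log n / (n : ℝ)) atTop (𝓝 0) :=
      Real.isLittleO_log_id_atTop.tendsto_div_nhds_zero.comp tendsto_natCast_atTop_atTop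
    have h2 := h1.const_mul (2 * κ * j)
    rw [mul_zero] at h2
    filter_upwards [h2.eventually (ge_mem_nhds (by positivity : 0 < η / 4))] with n hn
    calc _ = 2 * κ * j * (Real.log n / n) := by ring
      _ ≤ _ := hn
  have hfloor : Tendsto (fun n : ℕ => ⌊(n : ℝ) ^ a⌋₊) atTop atTop :=
    tendsto_nat_floor_atTop.comp ((tendsto_rpow_atTop ha).comp tendsto_natCast_atTop_atTop)
  -- The approximant uses finitely many elements, all of which eventually enter the growing finite
  -- dictionaries.
  have hmem : ∀ᶠ n : ℕ in atTop, ∀ i, φ i ∈ D ⌊(n : ℝ) ^ a⌋₊ := by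
    refine eventually_all.2 fun i => ?_
    have h1 := hφ i
    rw [← hD.iUnion_eq] at h1
    obtain ⟨m, hm⟩ := Set.mem_iUnion.1 h1
    filter_upwards [hfloor.eventually_ge_atTop m] with n hn
    exact hD.mono hn hm
  filter_upwards [hlim1, hlim2, hmem, eventually_ge_atTop 2] with n h1 h2 h3 h4
  refine le_trans (GreedyLearning.upperExpectation_squaredError_le (b := B + 1) (a := a) (κ := κ)
    (lam := lam) hB (by linarith) hb hlam (by rw [hlam_def, mul_inv_cancel₀ (by positivity)])
    (by linarith) hy h4 (fun g hg => (hdict g (hmemdict _ g hg)).1) ?_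
    (fun z => hfhat n (by omega) z) c φ h3 (fun i => (hdict _ (hφ i)).2) hj)
    (le_trans (ENNReal.ofReal_le_ofReal ?_) hηε)
  · exact (Nat.cast_le.2 (hD.card_le _)).trans (Nat.floor_le (by positivity))
  · linarith
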